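/- Let $M$ be the data structure that maintains a version counter $v$ (initially $0$) and boundaries $n^*_1,\dots,n^*_v\in\mathbb N$ under the following operations. - $\mathrm{add}(n)$: increments $v$ by one, sets $n^*_v=n$, and overwrites by $n$ every boundary $n^*_i$ ($1\le i\le v-1$) that is larger than $n$. - $\mathrm{remove}(j)$, where $0\le j\le v$: removes the boundaries of the largest $j$ versions and decrements $v$ by $j$. - $\mathrm{minbound}(u)$: returns $n^*_u$ (if $1\le u\le v$; for other $u$ the answer is unspecified). The model is the word RAM with word length $w$: the unit-cost instructions are addition, subtraction, multiplication, integer division, bitwise Boolean operations and shifts on $w$-bit words, unsigned comparisons with conditional jumps, constants, register copies, and indirect loads and stores. Programs do not depend on $w$, and all arguments of operations are $w$-bit numbers. For every constant $c$, the structure $M$ can be implemented for at most $cw$ versions such that it uses $O(w)$ words of memory. More precisely, there are fixed programs for an initialization and for the three operations, and constants $K,C,w_0$ (all depending only on $c$), such that the following holds for every word length $w\ge w_0$ on a memory of $Kw$ words with arbitrary initial content. The initialization, which receives $w$ as its argument, ends within $Cw$ steps. After it, in every sequence of operations during which $M$ never has more than $cw$ versions, every call halts without accessing an address outside the $Kw$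 words and every call of $\mathrm{minbound}$ is answered correctly; every single call of $\mathrm{minbound}$ and of $\mathrm{remove}$ takes at most $C$ steps, and if the sequence contains $a$ calls of $\mathrm{add}$, these calls together take at most $C\cdot a$ steps (that is, $\mathrm{add}$ runs in amortized constant time). -/

import Mathlib

/-! ## A word RAM with a step count

The memory has `S` words of `w` bits each. The unit-cost instructions are the usual ones: addition,
subtraction, multiplication, integer division, bitwise Boolean operations and shifts on `w`-bit
words (all modulo `2 ^ w`, unsigned), constants, register-to-register copies, indirect loads and
stores, and (conditional) jumps. A program is a finite list of instructions, so that it mentions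
only finitely many registers, and it does not depend on the word length. -/

namespace WordRAM

/-- Binary operations on words. -/
inductive BinOp where
  | add | sub | mul | div | and | or | xor | shl | shr

/-- The value of a binary operation (division by zero yields zero; a shift by `w` or more positions
yields zero). -/
def BinOp.eval {w : ℕ} : BinOp → BitVec w → BitVec w → BitVec w
  | .add, x, y => x + y
  | .sub, x, y => x - y
  | .mul, x, y => x * y
  | .div, x, y => x / y
  | .and, x, y => x &&& y
  | .or, x, y => x ||| y
  | .xor, x, y => x ^^^ y
  | .shl, x, y => x <<< y
  | .shr, x, y => x >>> y

/-- Instructions; registers and jump targets are given by natural numbers. -/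
inductive Instr where
  /-- `r_d := k mod 2 ^ w` -/
  | const (d k : ℕ)
  /-- `r_d := r_s` -/
  | copy (d s : ℕ)
  /-- `r_d := r_s o r_t` -/
  | op (o : BinOp) (d s t : ℕ)
  /-- `r_d := mem[r_a]` -/
  | load (d a : ℕ)
  /-- `mem[r_a] := r_s` -/
  | store (a s : ℕ)
  /-- continue at `l` -/
  | jump (l : ℕ)
  /-- continue at `l` if `r_s = r_t` -/
  | jumpEq (s t l : ℕ)
  /-- continue at `l` if `r_s < r_t` (as unsigned numbers) -/
  | jumpLt (s t l : ℕ)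
  | halt

abbrev Program := List Instr

/-- A memory of `S` words of `w` bits. -/
abbrev Memory (w S : ℕ) := Fin S → BitVec w

structure State (w S : ℕ) where
  pc : ℕ
  regs : ℕ → BitVec w
  mem : Memory w S

/-- Write `x` into register `d` and go on to the next instruction. -/
def State.setReg {w S : ℕ} (s : State w S) (d : ℕ) (x : BitVec w) : State w S :=
  { s with pc := s.pc + 1, regs := Function.update s.regs d x }

/-- One step. There is none at a `halt`, none outside the program, and none for an access to an
address outside the `S` words of memory. -/
def step {w S : ℕ} (P : Program) (s : State w S) : Option (State w S) :=
  match P[s.pc]? with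
  | none => none
  | some .halt => none
  | some (.const d k) => some (s.setReg d (BitVec.ofNat w k))
  | some (.copy d r) => some (s.setReg d (s.regs r))
  | some (.op o d r t) => some (s.setReg d (o.eval (s.regs r) (s.regs t)))
  | some (.load d a) =>
      if h : (s.regs a).toNat < S then some (s.setReg d (s.mem ⟨(s.regs a).toNat, h⟩)) else none
  | some (.store a r) =>
      if h : (s.regs a).toNat < S then
        some { s with
          pc := s.pc + 1
          mem := Function.update s.mem ⟨(s.regs a).toNat, h⟩ (s.regs r) }
      else none
  | some (.jump l) => some { s with pc := l }
  | some (.jumpEq r t l) => some { s with pc := if s.regs r = s.regs t then l else s.pc + 1 }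
  | some (.jumpLt r t l) =>
      some { s with pc := if (s.regs r).toNat < (s.regs t).toNat then l else s.pc + 1 }

/-- `t` successive steps. -/
def steps {w S : ℕ} (P : Program) : ℕ → State w S → Option (State w S)
  | 0, s => some s
  | t + 1, s => (step P s).bind (steps P t)

/-- `Call P m x t m' y`: started at its first instruction on the memory content `m`, with the
argument `x` in register `0` and all other registers `0`, the program `P` reaches a `halt` after
exactly `t` steps, leaves the memory content `m'` and returns `y` in register `0`. -/
def Call {w S : ℕ} (P : Program) (m : Memory w S) (x : BitVec w) (t : ℕ) (m' : Memory w S)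
    (y : BitVec w) : Prop :=
  ∃ s : State w S,
    steps P t ⟨0, Function.update (fun _ => 0) 0 x, m⟩ = some s ∧
    P[s.pc]? = some .halt ∧ s.mem = m' ∧ s.regs 0 = y

end WordRAM

/-! ## The version-boundary structure -/

namespace VersionBoundary

/-- The abstract state: the list `[n*_1, …, n*_v]` of the boundaries of the versions `1, …, v`.
Its length is the version counter `v`. -/
abbrev Bounds := List ℕ

/-- Increment the version counter `v`, set `n*_v = n`, and overwrite every earlier boundary
that is larger than `n` by `n`. -/
def Bounds.add (L : Bounds) (n : ℕ) : Bounds :=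
  L.map (fun b => if n < b then n else b) ++ [n]

/-- Decrement the version counter by `j` and drop the boundaries of the largest `j` versions. -/
def Bounds.remove (L : Bounds) (j : ℕ) : Bounds :=
  L.take (L.length - j)

/-- The boundary `n*_u`, which exists for `1 ≤ u ≤ v`. -/
def Bounds.minbound (L : Bounds) : ℕ → Option ℕ
  | 0 => none
  | u + 1 => L[u]?

/-- An operation with its argument. -/
inductive Op where
  | add (n : ℕ)
  | remove (j : ℕ)
  | minbound (u : ℕ)

def Op.isAdd : Op → Bool
  | .add _ => true
  | _ => false

/-- `Legal w k L ops`: performed from the state `L`, the sequence `ops` of operations never makes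
more than `k` versions, removes only versions that exist, and all its arguments are `w`-bit
numbers. -/
def Legal (w k : ℕ) : Bounds → List Op → Prop
  | _, [] => True
  | L, .add n :: ops => n < 2 ^ w ∧ L.length + 1 ≤ k ∧ Legal w k (L.add n) ops
  | L, .remove j :: ops => j < 2 ^ w ∧ j ≤ L.length ∧ Legal w k (L.remove j) ops
  | L, .minbound u :: ops => u < 2 ^ w ∧ Legal w k L ops

/-- Word RAM code for the initialization and the three operations. -/
structure Implementation where
  init : WordRAM.Program
  add : WordRAM.Program
  remove : WordRAM.Program
  minbound : WordRAM.Program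

/-- `Executes I m L log`: let `m` be the memory content and `L` the abstract state. If the
operations listed in `log` are called one after the other, each call on the memory content that
the preceding one left, then every call halts, the number of its steps is the one listed with it
in `log`, and every call `minbound u` for which `n*_u` exists returns `n*_u`. -/
inductive Executes (I : Implementation) {w S : ℕ} :
    WordRAM.Memory w S → Bounds → List (Op × ℕ) → Prop
  | nil (m : WordRAM.Memory w S) (L : Bounds) : Executes I m L []
  | add (m m' : WordRAM.Memory w S) (L : Bounds) (n t : ℕ) (y : BitVec w) (log : List (Op × ℕ))
      (hcall : WordRAM.Call I.add m (BitVec.ofNat w n) t m' y)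
      (hrest : Executes I m' (L.add n) log) :
      Executes I m L ((.add n, t) :: log)
  | remove (m m' : WordRAM.Memory w S) (L : Bounds) (j t : ℕ) (y : BitVec w)
      (log : List (Op × ℕ))
      (hcall : WordRAM.Call I.remove m (BitVec.ofNat w j) t m' y)
      (hrest : Executes I m' (L.remove j) log) :
      Executes I m L ((.remove j, t) :: log)
  | minbound (m m' : WordRAM.Memory w S) (L : Bounds) (u t : ℕ) (y : BitVec w)
      (log : List (Op × ℕ))
      (hcall : WordRAM.Call I.minbound m (BitVec.ofNat w u) t m' y)
      (hresult : ∀ b, L.minbound u = some b → y.toNat = b)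
      (hrest : Executes I m' L log) :
      Executes I m L ((.minbound u, t) :: log)

end VersionBoundary

/-! The boundaries are always nondecreasing in the version, so equal ones form intervals ("groups").
One mark bit per version records the last version of each group, and only these group ends carry
data: the common boundary and a link to the preceding end. Version `0`, with boundary `0`, is a
permanent sentinel end (`Chain`, `Represents`).

For `minbound u`, the next mark at or after `u` has the right boundary. There are only `c + 1` mark
words, so a scan of them takes constant time. `remove` finds the end of the group of the new last
version, copies its data there and marks it; marks beyond the last version become stale and are
never read as ends, since the last version is itself marked. `add n` pops ends with boundaries above
`n` along the links and then marks the new version. The potential is the number of ends among `1, …,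
v`: each pop lowers it by one, `add` finally raises it by one, and `remove` never raises it. This
gives the amortized bound.

The RAM has no instruction for the index of a set bit. The scan isolates the lowest bit as a word `2
^ k`, and data is addressed by `2 ^ k % M` instead of `k`. With `M = 3 ^ (j + 1)` the powers of two
with exponents below `2 * 3 ^ j` are distinct modulo `M`, because 2 is a primitive root
(`two_pow_mod_three_pow_inj`). Some power of three lies in `[2 * w, 6 * w)`, so this perfect hash
needs only linear space, and initialization finds it by repeated tripling. The data slots need no
clearing. -/

namespace WordRAM

/-! ### Reasoning about halting programs and their step counts. -/

variable {w S : ℕ}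

/-- The word at address `a`, with value `0` outside the memory. -/
def Memory.get (m : Memory w S) (a : ℕ) : BitVec w :=
  if h : a < S then m ⟨a, h⟩ else 0

/-- Overwrite the word at address `a`. -/
def Memory.put (m : Memory w S) (a : ℕ) (x : BitVec w) : Memory w S :=
  fun i => if (i : ℕ) = a then x else m i

theorem Memory.get_put (m : Memory w S) {a : ℕ} (ha : a < S) (x : BitVec w) (b : ℕ) :
    (m.put a x).get b = if b = a then x else m.get b := by
  unfold Memory.get Memory.put
  split_ifs <;> simp_all

theorem Memory.update_eq_put (m : Memory w S) {a : ℕ} (ha : a < S) (x : BitVec w) :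
    Function.update m ⟨a, ha⟩ x = m.put a x := by
  funext i
  simp [Memory.put, Function.update_apply, Fin.ext_iff]

/-- Started in the state `s`, the program halts, and the number of steps, the final memory content
and the returned word satisfy `Q`. -/
def Ends (P : Program) (s : State w S) (Q : ℕ → Memory w S → BitVec w → Prop) : Prop :=
  ∃ t s', steps P t s = some s' ∧ P[s'.pc]? = some .halt ∧ Q t s'.mem (s'.regs 0)

variable {P : Program} {p : ℕ} {r : ℕ → BitVec w} {m : Memory w S}
  {Q : ℕ → Memory w S → BitVec w → Prop}

theorem Ends.call {x : BitVec w} (h : Ends P ⟨0, Function.update (fun _ => 0) 0 x, m⟩ Q) :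
    ∃ t m' y, Call P m x t m' y ∧ Q t m' y := by
  obtain ⟨t, s', h1, h2, h3⟩ := h
  exact ⟨t, _, _, ⟨s', h1, h2, rfl, rfl⟩, h3⟩

theorem Ends.of_step {s s' : State w S} (hs : step P s = some s')
    (h : Ends P s' fun t => Q (t + 1)) : Ends P s Q := by
  obtain ⟨t, s'', h1, h2, h3⟩ := h
  exact ⟨t + 1, s'', by simp [steps, hs, h1], h2, h3⟩

theorem Ends.mono {s : State w S} {Q' : ℕ → Memory w S → BitVec w → Prop} (h : Ends P s Q)
    (hQ : ∀ t m y, Q t m y → Q' t m y) : Ends P s Q' := by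
  obtain ⟨t, s', h1, h2, h3⟩ := h
  exact ⟨t, s', h1, h2, hQ _ _ _ h3⟩

theorem Ends.halt (hp : P[p]? = some .halt) (h : Q 0 m (r 0)) : Ends P ⟨p, r, m⟩ Q :=
  ⟨0, ⟨p, r, m⟩, rfl, hp, h⟩

theorem Ends.jump {l : ℕ} (hp : P[p]? = some (.jump l))
    (h : Ends P ⟨l, r, m⟩ fun t => Q (t + 1)) : Ends P ⟨p, r, m⟩ Q :=
  .of_step (by simp [step, hp]) h

theorem Ends.jumpLt_pos {a b l : ℕ} (hp : P[p]? = some (.jumpLt a b l))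
    (hlt : (r a).toNat < (r b).toNat)
    (h : Ends P ⟨l, r, m⟩ fun t => Q (t + 1)) : Ends P ⟨p, r, m⟩ Q :=
  .of_step (by simp [step, hp, hlt]) h

theorem Ends.jumpLt_neg {a b l : ℕ} (hp : P[p]? = some (.jumpLt a b l))
    (hlt : ¬ (r a).toNat < (r b).toNat)
    (h : Ends P ⟨p + 1, r, m⟩ fun t => Q (t + 1)) : Ends P ⟨p, r, m⟩ Q :=
  .of_step (by simp [step, hp, hlt]) h

/-- Weakest precondition of a block of instructions without jumps: all its memory accesses are
valid, and the registers and the memory content after it satisfy `R`. -/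
def Block : List Instr → (ℕ → BitVec w) → Memory w S →
    ((ℕ → BitVec w) → Memory w S → Prop) → Prop
  | [], r, m, R => R r m
  | .const d k :: B, r, m, R => Block B (Function.update r d (BitVec.ofNat w k)) m R
  | .copy d s :: B, r, m, R => Block B (Function.update r d (r s)) m R
  | .op o d s t :: B, r, m, R => Block B (Function.update r d (o.eval (r s) (r t))) m R
  | .load d a :: B, r, m, R =>
      (r a).toNat < S ∧ Block B (Function.update r d (m.get (r a).toNat)) m R
  | .store a s :: B, r, m, R => (r a).toNat < S ∧ Block B r (m.put (r a).toNat (r s)) R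
  | _, _, _, _ => False

/-- Straight-line code costs one step per instruction, so executing a block shifts the program
counter and the time by the same amount, its length. -/
theorem Block.ends {B : List Instr} (hp : B <+: P.drop p)
    (h : Block B r m fun r' m' => Ends P ⟨p + B.length, r', m'⟩ fun t => Q (t + B.length)) :
    Ends P ⟨p, r, m⟩ Q := by
  induction B generalizing p r m Q with
  | nil => exact h
  | cons i B ih =>
    obtain ⟨l, hl⟩ := hp
    have hi : P[p]? = some i := by
      have := congrArg (fun l => l[0]?) hl
      simpa using this.symm
    have hB : B <+: P.drop (p + 1) := by
      refine ⟨l, ?_⟩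
      have := congrArg List.tail hl
      simpa using this
    have key : ∀ r' m', step P ⟨p, r, m⟩ = some ⟨p + 1, r', m'⟩ →
        Block B r' m' (fun r'' m'' => Ends P ⟨p + (i :: B).length, r'', m''⟩
          fun t => Q (t + (i :: B).length)) → Ends P ⟨p, r, m⟩ Q := by
      intro r' m' hs h'
      refine .of_step hs (ih hB ?_)
      have e1 : p + (i :: B).length = p + 1 + B.length := by simp; omega
      have e2 : ∀ t, t + (i :: B).length = t + B.length + 1 := by intro t; simp; omega
      simpa only [e1, e2] using h'
    cases i with
    | const d k => exact key _ _ (by simp [step, hi, State.setReg]) h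
    | copy d s => exact key _ _ (by simp [step, hi, State.setReg]) h
    | op o d s t => exact key _ _ (by simp [step, hi, State.setReg]) h
    | load d a =>
      exact key _ _ (by simp [step, hi, State.setReg, h.1, Memory.get]) h.2
    | store a s =>
      exact key _ _ (by simp [step, hi, h.1, Memory.update_eq_put]) h.2
    | jump l => exact h.elim
    | jumpEq a b l => exact h.elim
    | jumpLt a b l => exact h.elim
    | halt => exact h.elim

theorem Block.append {A B : List Instr} {R : (ℕ → BitVec w) → Memory w S → Prop}
    (h : Block A r m fun r' m' => Block B r' m' R) : Block (A ++ B) r m R := by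
  induction A generalizing r m with
  | nil => exact h
  | cons i A ih =>
    cases i with
    | const d k => exact ih h
    | copy d s => exact ih h
    | op o d s t => exact ih h
    | load d a => exact ⟨h.1, ih h.2⟩
    | store a s => exact ⟨h.1, ih h.2⟩
    | jump l => exact h.elim
    | jumpEq a b l => exact h.elim
    | jumpLt a b l => exact h.elim
    | halt => exact h.elim

theorem Block.mono {B : List Instr} {R R' : (ℕ → BitVec w) → Memory w S → Prop}
    (h : Block B r m R) (hR : ∀ r m, R r m → R' r m) : Block B r m R' := by
  induction B generalizing r m with
  | nil => exact hR _ _ h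
  | cons i B ih =>
    cases i with
    | const d k => exact ih h
    | copy d s => exact ih h
    | op o d s t => exact ih h
    | load d a => exact ⟨h.1, ih h.2⟩
    | store a s => exact ⟨h.1, ih h.2⟩
    | jump l => exact h.elim
    | jumpEq a b l => exact h.elim
    | jumpLt a b l => exact h.elim
    | halt => exact h.elim

end WordRAM

/-! ### Word-level bit tricks, and powers of two modulo powers of three. -/

theorem BitVec.ofNat_div_ofNat {w a b : ℕ} (ha : a < 2 ^ w) (hb : b < 2 ^ w) :
    BitVec.ofNat w a / BitVec.ofNat w b = BitVec.ofNat w (a / b) := by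
  apply BitVec.eq_of_toNat_eq
  rw [BitVec.toNat_udiv, BitVec.toNat_ofNat, BitVec.toNat_ofNat, BitVec.toNat_ofNat,
    Nat.mod_eq_of_lt ha, Nat.mod_eq_of_lt hb,
    Nat.mod_eq_of_lt (lt_of_le_of_lt (Nat.div_le_self _ _) ha)]

theorem BitVec.one_shiftLeft_ofNat {w k : ℕ} (hk : k < w) :
    BitVec.ofNat w 1 <<< BitVec.ofNat w k = BitVec.ofNat w (2 ^ k) := by
  have hk' : k < 2 ^ w := hk.trans Nat.lt_two_pow_self
  rw [BitVec.shiftLeft_eq', BitVec.toNat_ofNat, Nat.mod_eq_of_lt hk']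
  rw [← BitVec.twoPow_eq]
  apply BitVec.eq_of_toNat_eq
  rw [BitVec.toNat_twoPow, BitVec.toNat_ofNat]

theorem BitVec.getLsbD_ofNat_two_pow {w k : ℕ} (hk : k < w) (i : ℕ) :
    (BitVec.ofNat w (2 ^ k)).getLsbD i = decide (i = k) := by
  rw [BitVec.getLsbD_ofNat, Nat.testBit_two_pow]
  by_cases h : i = k <;> simp [h, hk, Ne.symm]

/-- The least set bit of `x` is isolated by `x &&& -x`. -/
theorem BitVec.and_neg_eq {w k : ℕ} {x : BitVec w} (hk : x.getLsbD k = true)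
    (hlt : ∀ i < k, x.getLsbD i = false) : x &&& (0#w - x) = BitVec.ofNat w (2 ^ k) := by
  have hkw : k < w := BitVec.lt_of_getLsbD hk
  apply BitVec.eq_of_getLsbD_eq
  intro i hi
  rw [BitVec.getLsbD_and, BitVec.getLsbD_ofNat_two_pow hkw, BitVec.zero_sub, BitVec.getLsbD_neg]
  rcases _root_.lt_trichotomy i k with h | h | h
  · simp [hlt i h, h.ne]
  · subst h
    have : ¬ ∃ j < i, x.getLsbD j = true := by
      rintro ⟨j, hj, hx⟩
      simp [hlt j hj] at hx
    simp [hk, hkw, this]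
  · have : ∃ j < i, x.getLsbD j = true := ⟨k, h, hk⟩
    cases hx : x.getLsbD i <;> simp [hi, this, h.ne']

/-- Used as a mask: a conjunction with `-2 ^ k` removes exactly the bits below `k`. -/
theorem BitVec.getLsbD_neg_two_pow {w k : ℕ} (hk : k < w) {i : ℕ} (hi : i < w) :
    (0#w - BitVec.ofNat w (2 ^ k)).getLsbD i = decide (k ≤ i) := by
  rw [BitVec.zero_sub, BitVec.getLsbD_neg]
  simp only [BitVec.getLsbD_ofNat_two_pow hk, decide_eq_true_eq, hi, decide_true, Bool.true_and,
    exists_eq_right]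
  by_cases h : i = k
  · simp [h]
  · by_cases h' : k < i
    · simp [h, h', h'.le]
    · have : ¬ k ≤ i := by omega
      simp [h, h', this]

/-- Working modulo 3 forces `d = 2 * e`, and lifting the exponent for `4 ^ e - 1` then gives `3 ^ j
∣ e`. In other words, 2 has order `2 * 3 ^ j` or a multiple of it. -/
theorem three_pow_dvd_two_pow_sub_one {j d : ℕ} (hd : 3 ^ (j + 1) ∣ 2 ^ d - 1) :
    2 * 3 ^ j ∣ d := by
  rcases Nat.eq_zero_or_pos d with rfl | hpos
  · simp
  have h3 : 3 ∣ 2 ^ d - 1 := (dvd_pow_self 3 (Nat.succ_ne_zero j)).trans hd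
  have heven : Even d := by
    by_contra hodd
    rw [Nat.not_even_iff_odd] at hodd
    obtain ⟨e, rfl⟩ := hodd
    have h2 : 2 ^ (2 * e + 1) % 3 = 2 := by
      rw [pow_succ, pow_mul, Nat.mul_mod, Nat.pow_mod]; simp
    have h1 : 1 ≤ 2 ^ (2 * e + 1) := Nat.one_le_two_pow
    generalize 2 ^ (2 * e + 1) = a at h1 h2 h3
    omega
  obtain ⟨e, rfl⟩ := heven
  have he : e ≠ 0 := by omega
  have h4 : 2 ^ (e + e) - 1 = 4 ^ e - 1 ^ e := by
    rw [← two_mul, pow_mul]; simp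
  -- Lifting the exponent: the 3-adic valuation of `4 ^ e - 1` is one more than that of `e`.
  have hv := padicValNat.pow_sub_pow (p := 3) (x := 4) (y := 1) (by decide) (by norm_num)
    (by norm_num) (by norm_num) he
  have h1 : 3 ^ j ∣ e := by
    rw [h4] at hd
    have hne : 4 ^ e - 1 ^ e ≠ 0 := by
      have : 1 < 4 ^ e := Nat.one_lt_pow he (by norm_num)
      simp; omega
    rw [padicValNat_dvd_iff_le hne, hv] at hd
    rw [padicValNat_dvd_iff_le he]
    have : padicValNat 3 (4 - 1) = 1 := by simp
    omega
  rw [← two_mul]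
  exact mul_dvd_mul_left 2 h1

/-- The powers of two with small exponents are pairwise incongruent modulo `3 ^ (j + 1)`. -/
theorem two_pow_mod_three_pow_inj {j k l : ℕ} (hk : k < 2 * 3 ^ j) (hl : l < 2 * 3 ^ j)
    (h : 2 ^ k % 3 ^ (j + 1) = 2 ^ l % 3 ^ (j + 1)) : k = l := by
  wlog hkl : k ≤ l generalizing k l
  · exact (this hl hk h.symm (by omega)).symm
  have h1 : 3 ^ (j + 1) ∣ 2 ^ l - 2 ^ k := (Nat.modEq_iff_dvd' (Nat.pow_le_pow_right (by norm_num) hkl)).1 h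
  have h2 : 2 ^ l - 2 ^ k = 2 ^ k * (2 ^ (l - k) - 1) := by
    rw [Nat.mul_sub, ← pow_add, Nat.add_sub_cancel' hkl, mul_one]
  rw [h2] at h1
  have hc : Nat.Coprime (3 ^ (j + 1)) (2 ^ k) := Nat.Coprime.pow _ _ (by norm_num)
  have := Nat.eq_zero_of_dvd_of_lt (three_pow_dvd_two_pow_sub_one (hc.dvd_of_dvd_mul_left h1))
    (by omega)
  omega

/-! ### Memory layout: three parameters, `c + 1` mark words, then hashed pairs of data words. -/

namespace VersionBoundary

open WordRAM

variable {c w M S : ℕ}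

/-- The parameters of the memory layout fit together. -/
structure Layout (c w M S : ℕ) : Prop where
  w_pos : 0 < w
  M_pos : 0 < M
  inj : ∀ k < w, ∀ l < w, 2 ^ k % M = 2 ^ l % M → k = l
  cw_lt : c * w < 2 ^ w
  size : c + 4 + 2 * ((c + 1) * M) ≤ S
  S_le : S ≤ 2 ^ w

/-- The address of the data word in the block `q` that belongs to the bit `k`. -/
def slot (c M q k : ℕ) : ℕ := c + 4 + 2 * (q * M + 2 ^ k % M)

/-- The address of the data of version `i`: its boundary, followed by the preceding group end. -/
def dataAddr (c w M i : ℕ) : ℕ := slot c M (i / w) (i % w)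

/-- Whether version `i` is the last version of a group of versions with a common boundary. -/
def isEnd (m : Memory w S) (i : ℕ) : Bool := (m.get (3 + i / w)).getLsbD (i % w)

namespace Layout

variable (hl : Layout c w M S)
include hl

omit hl in
theorem div_le {i : ℕ} (hi : i ≤ c * w) : i / w ≤ c :=
  Nat.div_le_of_le_mul (by rwa [mul_comm])

theorem mod_lt (i : ℕ) : i % w < w := Nat.mod_lt _ hl.w_pos

theorem word_lt {q : ℕ} (hq : q ≤ c) : 3 + q < S := by have := hl.size; omega

theorem slot_lt {q : ℕ} (hq : q ≤ c) (k : ℕ) : slot c M q k + 1 < S := by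
  have h1 := hl.size
  have h2 : 2 ^ k % M < M := Nat.mod_lt _ hl.M_pos
  have h3 : q * M ≤ c * M := Nat.mul_le_mul_right _ hq
  rw [add_mul] at h1
  unfold slot
  omega

theorem dataAddr_lt {i : ℕ} (hi : i ≤ c * w) : dataAddr c w M i + 1 < S :=
  hl.slot_lt (div_le hi) _

/-- The residue lies below `M`, so the address determines both the block and the residue; the hash
is injective on bit positions. -/
theorem dataAddr_inj {i j : ℕ} (h : dataAddr c w M i = dataAddr c w M j) : i = j := by
  unfold dataAddr slot at h
  have h1 : 2 ^ (i % w) % M < M := Nat.mod_lt _ hl.M_pos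
  have h2 : 2 ^ (j % w) % M < M := Nat.mod_lt _ hl.M_pos
  have h3 : i / w * M + 2 ^ (i % w) % M = j / w * M + 2 ^ (j % w) % M := by omega
  have hq : i / w = j / w := by
    have := congrArg (· / M) h3
    simpa [Nat.mul_comm _ M, Nat.mul_add_div hl.M_pos, Nat.div_eq_of_lt h1,
      Nat.div_eq_of_lt h2] using this
  have hk : i % w = j % w := by
    rw [hq] at h3
    exact hl.inj _ (hl.mod_lt i) _ (hl.mod_lt j) (by omega)
  rw [← Nat.div_add_mod i w, ← Nat.div_add_mod j w, hq, hk]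

-- Value words and link words never collide, by parity of the offset from `c + 4`.
omit hl in
theorem dataAddr_ne_succ (i j : ℕ) : dataAddr c w M i ≠ dataAddr c w M j + 1 := by
  unfold dataAddr slot
  omega

omit hl in
theorem lt_dataAddr (i : ℕ) : c + 3 < dataAddr c w M i := by
  unfold dataAddr slot
  omega

omit hl in
theorem isEnd_put_data (m : Memory w S) {i : ℕ} (hi : i ≤ c * w) {a : ℕ} (ha : c + 3 < a)
    (haS : a < S) (x : BitVec w) : isEnd (m.put a x) i = isEnd m i := by
  have := div_le hi
  rw [isEnd, isEnd, Memory.get_put _ haS, if_neg (by omega)]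

theorem isEnd_put_version (m : Memory w S) (x : BitVec w) (i : ℕ) :
    isEnd (m.put 0 x) i = isEnd m i := by
  have h0 : 0 < S := by have := hl.word_lt (Nat.zero_le c); omega
  have h1 : 3 + i / w ≠ 0 := by simp
  rw [isEnd, isEnd, Memory.get_put _ h0, if_neg h1]

theorem isEnd_put_word (m : Memory w S) {j : ℕ} (hj : j ≤ c * w) (x : BitVec w) (i : ℕ) :
    isEnd (m.put (3 + j / w) x) i = if i / w = j / w then x.getLsbD (i % w) else isEnd m i := by
  rw [isEnd, isEnd, Memory.get_put _ (hl.word_lt (div_le hj))]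
  simp only [Nat.add_left_cancel_iff]
  split_ifs <;> rfl

omit hl in
theorem mod_eq_iff {i j : ℕ} (h : i / w = j / w) : i % w = j % w ↔ i = j := by
  refine ⟨fun h' => ?_, fun h' => h' ▸ rfl⟩
  rw [← Nat.div_add_mod i w, ← Nat.div_add_mod j w, h, h']

theorem isEnd_set (m : Memory w S) {j : ℕ} (hj : j ≤ c * w) (i : ℕ) :
    isEnd (m.put (3 + j / w) (m.get (3 + j / w) ||| BitVec.ofNat w (2 ^ (j % w)))) i =
      (isEnd m i || decide (i = j)) := by
  rw [hl.isEnd_put_word m hj]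
  split_ifs with h
  · rw [BitVec.getLsbD_or, BitVec.getLsbD_ofNat_two_pow (hl.mod_lt j), isEnd, h]
    simp only [mod_eq_iff h]
  · have : i ≠ j := fun h' => h (h' ▸ rfl)
    simp [this]

/-- Popping applies this to a marked version, where the exclusive or clears the mark. -/
theorem isEnd_flip (m : Memory w S) {j : ℕ} (hj : j ≤ c * w) (i : ℕ) :
    isEnd (m.put (3 + j / w) (m.get (3 + j / w) ^^^ BitVec.ofNat w (2 ^ (j % w)))) i =
      (isEnd m i ^^ decide (i = j)) := by
  rw [hl.isEnd_put_word m hj]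
  split_ifs with h
  · rw [BitVec.getLsbD_xor, BitVec.getLsbD_ofNat_two_pow (hl.mod_lt j), isEnd, h]
    simp only [mod_eq_iff h]
  · have : i ≠ j := fun h' => h (h' ▸ rfl)
    simp [this]

end Layout

/-! ### Chains of group ends and how the operations change them. -/

/-- The versions `0, …, e` form groups with the common boundaries given by `B`; the group ends are
marked, and each of them carries the boundary and a link to the preceding one. -/
structure Chain (c M : ℕ) (m : Memory w S) (B : ℕ → ℕ) (e : ℕ) : Prop where
  top : isEnd m e = true
  val : ∀ i ≤ e, isEnd m i = true → m.get (dataAddr c w M i) = BitVec.ofNat w (B i)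
  eq_succ : ∀ i < e, isEnd m i = false → B i = B (i + 1)
  link : ∀ i ≤ e, 0 < i → isEnd m i = true → ∃ p < i, isEnd m p = true ∧
    m.get (dataAddr c w M i + 1) = BitVec.ofNat w p ∧ ∀ k, p < k → k < i → isEnd m k = false

namespace Chain

variable {m m' : Memory w S} {B B' : ℕ → ℕ} {e p n u v : ℕ}

theorem of_le (h : Chain c M m B e) (hpe : p ≤ e) (hp : isEnd m p = true) : Chain c M m B p where
  top := hp
  val i hi := h.val i (hi.trans hpe)
  eq_succ i hi := h.eq_succ i (hi.trans_le hpe)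
  link i hi := h.link i (hi.trans hpe)

theorem congr (h : Chain c M m B e) (hend : ∀ i ≤ e, isEnd m' i = isEnd m i)
    (hB : ∀ i ≤ e, B' i = B i)
    (hval : ∀ i ≤ e, m'.get (dataAddr c w M i) = m.get (dataAddr c w M i))
    (hlink : ∀ i ≤ e, m'.get (dataAddr c w M i + 1) = m.get (dataAddr c w M i + 1)) :
    Chain c M m' B' e where
  top := by rw [hend e le_rfl, h.top]
  val i hi hie := by
    rw [hval i hi, h.val i hi (by rwa [← hend i hi]), hB i hi]
  eq_succ i hi hie := by
    rw [hB i hi.le, hB (i + 1) hi, h.eq_succ i hi (by rwa [← hend i hi.le])]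
  link i hi h0 hie := by
    obtain ⟨p, h1, h2, h3, h4⟩ := h.link i hi h0 (by rwa [← hend i hi])
    refine ⟨p, h1, by rw [hend p (by omega), h2], by rw [hlink i hi, h3], fun k hk hki => ?_⟩
    rw [hend k (by omega), h4 k hk hki]

/-- This is why the next mark answers a query: boundaries change only across a mark. -/
theorem eq_of_no_end (h : Chain c M m B v) (hue : u ≤ e) (hev : e ≤ v)
    (hno : ∀ k, u ≤ k → k < e → isEnd m k = false) : B u = B e := by
  induction e, hue using Nat.le_induction with
  | base => rfl
  | succ e hue ih =>
    rw [ih (by omega) fun k hk hk' => hno k hk (by omega)]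
    exact h.eq_succ e (by omega) (hno e hue (by omega))

/-- Appending a version whose boundary replaces those of the versions after `e`. -/
theorem push (h : Chain c M m B e) (hev : e ≤ v)
    (hend : ∀ i ≤ v + 1, isEnd m' i = (isEnd m i || decide (i = v + 1)))
    (hno : ∀ i, e < i → i ≤ v → isEnd m i = false)
    (hB : ∀ i ≤ e, B' i = B i) (hB' : ∀ i, e < i → i ≤ v + 1 → B' i = n)
    (hval : ∀ i ≤ e, m'.get (dataAddr c w M i) = m.get (dataAddr c w M i))
    (hlink : ∀ i ≤ e, m'.get (dataAddr c w M i + 1) = m.get (dataAddr c w M i + 1))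
    (hval' : m'.get (dataAddr c w M (v + 1)) = BitVec.ofNat w n)
    (hlink' : m'.get (dataAddr c w M (v + 1) + 1) = BitVec.ofNat w e) :
    Chain c M m' B' (v + 1) := by
  have hend' : ∀ i ≤ e, isEnd m' i = isEnd m i := by
    intro i hi
    have : i ≠ v + 1 := by omega
    simp [hend i (by omega), this]
  have h' := h.congr hend' hB hval hlink
  have hno' : ∀ i, e < i → i ≤ v → isEnd m' i = false := by
    intro i hi hi'
    have : i ≠ v + 1 := by omega
    simp [hend i (by omega), this, hno i hi hi']
  have hcase : ∀ i ≤ v + 1, isEnd m' i = true → i ≤ e ∨ i = v + 1 := by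
    intro i hi hie
    by_contra hc
    rw [hno' i (by omega) (by omega)] at hie
    simp at hie
  constructor
  · simp [hend (v + 1) le_rfl]
  · intro i hi hie
    rcases hcase i hi hie with h1 | rfl
    · exact h'.val i h1 hie
    · rw [hval', hB' _ (by omega) le_rfl]
  · intro i hi hie
    by_cases h1 : i < e
    · exact h'.eq_succ i h1 hie
    · have : i ≠ e := by
        rintro rfl
        rw [h'.top] at hie
        simp at hie
      rw [hB' i (by omega) (by omega), hB' (i + 1) (by omega) (by omega)]
  · intro i hi h0 hie
    rcases hcase i hi hie with h1 | rfl
    · exact h'.link i h1 h0 hie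
    · exact ⟨e, by omega, h'.top, hlink', fun k hk hk' => hno' k hk (by omega)⟩

/-- Dropping the versions after `u`, where `e` is the group end of `u`. -/
theorem truncate (h : Chain c M m B v) (hue : u ≤ e) (hev : e ≤ v) (he : isEnd m e = true)
    (hno : ∀ k, u ≤ k → k < e → isEnd m k = false)
    (hend : ∀ i ≤ u, isEnd m' i = (isEnd m i || decide (i = u)))
    (hB : ∀ i ≤ u, B' i = B i)
    (hval : ∀ i < u, m'.get (dataAddr c w M i) = m.get (dataAddr c w M i))
    (hlink : ∀ i < u, m'.get (dataAddr c w M i + 1) = m.get (dataAddr c w M i + 1))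
    (hval' : m'.get (dataAddr c w M u) = m.get (dataAddr c w M e))
    (hlink' : m'.get (dataAddr c w M u + 1) = m.get (dataAddr c w M e + 1)) :
    Chain c M m' B' u := by
  have hend' : ∀ i < u, isEnd m' i = isEnd m i := by
    intro i hi
    simp [hend i hi.le, hi.ne]
  constructor
  · simp [hend u le_rfl]
  · intro i hi hie
    rcases hi.lt_or_eq with h1 | rfl
    · rw [hval i h1, h.val i (by omega) (by rwa [← hend' i h1]), hB i hi]
    · rw [hval', h.val e hev he, hB i hi, h.eq_of_no_end hue hev hno]
  · intro i hi hie
    rw [hB i hi.le, hB (i + 1) hi, h.eq_succ i (by omega) (by rwa [← hend' i hi])]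
  · intro i hi h0 hie
    rcases hi.lt_or_eq with h1 | rfl
    · obtain ⟨p, h2, h3, h4, h5⟩ := h.link i (by omega) h0 (by rwa [← hend' i h1])
      exact ⟨p, h2, by rw [hend' p (by omega), h3], by rw [hlink i h1, h4], fun k hk hk' => by
        rw [hend' k (by omega), h5 k hk hk']⟩
    · obtain ⟨p, h2, h3, h4, h5⟩ := h.link e hev (by omega) he
      -- No version from the cut up to just before `e` is marked, so the predecessor of `e` is below
      -- the cut and the copied link stays valid.
      have hp : p < i := by
        by_contra hc
        rw [hno p (by omega) h2] at h3
        simp at h3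
      exact ⟨p, hp, by rw [hend' p hp, h3], by rw [hlink', h4], fun k hk hk' => by
        rw [hend' k hk', h5 k hk (by omega)]⟩

end Chain

/-! ### The potential function. -/

/-- The number of marked group ends among the versions `1, …, v`. -/
def numEnds (m : Memory w S) (v : ℕ) : ℕ := {i ∈ Finset.Ioc 0 v | isEnd m i = true}.card

theorem numEnds_flip {m m' : Memory w S} {e v : ℕ} (he : isEnd m e = true) (h0 : 0 < e)
    (hev : e ≤ v) (hend : ∀ i ≤ v, isEnd m' i = (isEnd m i ^^ decide (i = e))) :
    numEnds m' v + 1 = numEnds m v := by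
  have : ({i ∈ Finset.Ioc 0 v | isEnd m' i = true} : Finset ℕ) =
      ({i ∈ Finset.Ioc 0 v | isEnd m i = true} : Finset ℕ).erase e := by
    ext i
    simp only [Finset.mem_filter, Finset.mem_Ioc, Finset.mem_erase]
    constructor
    · rintro ⟨h1, h2⟩
      rw [hend i h1.2] at h2
      by_cases hi : i = e
      · simp [hi, he] at h2
      · simpa [hi, h1] using h2
    · rintro ⟨h1, h2, h3⟩
      exact ⟨h2, by simp [hend i h2.2, h1, h3]⟩
  unfold numEnds
  rw [this]
  exact Finset.card_erase_add_one (by simp [he, h0, hev])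

theorem numEnds_push {m m' : Memory w S} {v : ℕ}
    (hend : ∀ i ≤ v + 1, isEnd m' i = (isEnd m i || decide (i = v + 1))) :
    numEnds m' (v + 1) = numEnds m v + 1 := by
  have : ({i ∈ Finset.Ioc 0 (v + 1) | isEnd m' i = true} : Finset ℕ) =
      insert (v + 1) ({i ∈ Finset.Ioc 0 v | isEnd m i = true} : Finset ℕ) := by
    ext i
    simp only [Finset.mem_filter, Finset.mem_Ioc, Finset.mem_insert]
    constructor
    · rintro ⟨h1, h2⟩
      rw [hend i h1.2] at h2
      by_cases hi : i = v + 1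
      · exact .inl hi
      · exact .inr ⟨by omega, by simpa [hi] using h2⟩
    · rintro (rfl | ⟨h1, h2⟩)
      · simp [hend (v + 1) le_rfl]
      · exact ⟨by omega, by simp [hend i (by omega), h2]⟩
  unfold numEnds
  rw [this, Finset.card_insert_of_notMem (by simp)]

/-- The mark at `u` may be new, but it is paid for by the mark at `e`: sending `u` to `e` and fixing
the other ends is injective. -/
theorem numEnds_truncate {m m' : Memory w S} {u e v : ℕ} (hue : u ≤ e) (hev : e ≤ v)
    (he : isEnd m e = true)
    (hend : ∀ i ≤ u, isEnd m' i = (isEnd m i || decide (i = u))) :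
    numEnds m' u ≤ numEnds m v := by
  apply Finset.card_le_card_of_injOn fun i => if i = u then e else i
  · intro i hi
    simp only [Finset.coe_filter, Finset.mem_Ioc, Set.mem_ofPred_eq] at hi ⊢
    split_ifs with h
    · exact ⟨by omega, he⟩
    · exact ⟨by omega, by simpa [hend i hi.1.2, h] using hi.2⟩
  · intro i hi j hj h
    simp only [Finset.coe_filter, Finset.mem_Ioc, Set.mem_ofPred_eq] at hi hj h
    split_ifs at h <;> omega

/-! ### The abstract list with its sentinel, and the representation invariant. -/

/-- The boundary of version `i`, where version `0` has the boundary `0`. -/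
def Bounds.at (L : Bounds) (i : ℕ) : ℕ := (0 :: L).getD i 0

namespace Bounds

theorem at_of_minbound {L : Bounds} {u b : ℕ} (h : L.minbound u = some b) :
    u ≤ L.length ∧ L.at u = b := by
  cases u with
  | zero => simp [minbound] at h
  | succ u =>
    simp only [minbound] at h
    have := (List.getElem?_eq_some_iff.1 h).1
    exact ⟨this, by simp [Bounds.at, h]⟩

theorem length_add (L : Bounds) (n : ℕ) : (L.add n).length = L.length + 1 := by
  simp [add]

theorem length_remove (L : Bounds) (j : ℕ) : (L.remove j).length = L.length - j := by
  simp [remove]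

theorem at_add (L : Bounds) (n : ℕ) {i : ℕ} (hi : i ≤ L.length) :
    (L.add n).at i = min (L.at i) n := by
  cases i with
  | zero => simp [Bounds.at]
  | succ i =>
    have : i < L.length := hi
    simp [Bounds.at, add, List.getElem?_append, this]
    split_ifs <;> omega

theorem at_add_last (L : Bounds) (n : ℕ) : (L.add n).at (L.length + 1) = n := by
  simp [Bounds.at, add]

theorem at_remove (L : Bounds) {j i : ℕ} (hi : i ≤ L.length - j) :
    (L.remove j).at i = L.at i := by
  cases i with
  | zero => simp [Bounds.at]
  | succ i =>
    have : i < L.length - j := hi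
    simp only [Bounds.at, remove, List.getD_eq_getElem?_getD, List.getElem?_cons_succ,
      List.getElem?_take_of_lt this]

end Bounds

/-- The memory content `m` represents the list `L` of boundaries. -/
structure Represents (c M : ℕ) (m : Memory w S) (L : Bounds) : Prop where
  version : m.get 0 = BitVec.ofNat w L.length
  width : m.get 1 = BitVec.ofNat w w
  modulus : m.get 2 = BitVec.ofNat w M
  length_le : L.length ≤ c * w
  lt : ∀ i ≤ L.length, L.at i < 2 ^ w
  mono : ∀ i j, i ≤ j → j ≤ L.length → L.at i ≤ L.at j
  chain : Chain c M m L.at L.length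

end VersionBoundary

/-! ### The programs and their straight-line blocks. -/

namespace VersionBoundary

open WordRAM

/-- Load the constants and the parameters of the layout. -/
def setup (c : ℕ) : List Instr :=
  [.const 1 1, .const 2 2, .const 3 3, .const 4 (c + 4), .load 10 15, .load 11 1, .load 12 2]

/-- For the version in register `5`, compute the address of the word and the mask of its bit. -/
def locate : List Instr :=
  [.op .div 6 5 11, .op .mul 7 6 11, .op .sub 7 5 7, .op .shl 7 1 7, .op .add 6 6 3]

/-- Compute the address of the data word for the bit given by the registers `6` and `7`. -/
def address : List Instr :=
  [.op .sub 8 6 3, .op .mul 8 8 12, .op .div 9 7 12, .op .mul 9 9 12, .op .sub 9 7 9,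
    .op .add 8 8 9, .op .mul 8 8 2, .op .add 8 8 4]

/-- Read a word and clear the bits below the given one. -/
def maskWord : List Instr :=
  [.op .sub 13 15 7, .load 14 6, .op .and 14 14 13]

def nextWord : List Instr := [.op .add 6 6 1, .load 14 6]

/-- Isolate the lowest bit. -/
def lowestBit : List Instr := [.op .sub 13 15 14, .op .and 7 14 13]

/-- Find the group end of the version in register `5`; the code is to be placed at `p`. -/
def findEnd (p : ℕ) : List Instr :=
  locate ++ maskWord ++ [.jumpLt 15 14 (p + 12)] ++ nextWord ++ [.jump (p + 8)] ++ lowestBit ++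
    address

def initProgram (c : ℕ) : Program :=
  [.store 15 15, .const 1 1, .store 1 0, .const 3 3, .store 3 1, .const 4 (c + 6), .store 4 15,
    .const 12 1, .op .add 5 0 0] ++
  [.jumpLt 12 5 13] ++ [.const 2 2, .store 2 12] ++ [.halt] ++ [.op .mul 12 12 3] ++ [.jump 9]

def minboundProgram (c : ℕ) : Program :=
  setup c ++ [.jumpLt 10 0 32] ++ [.copy 5 0] ++ findEnd 9 ++ [.load 0 8] ++ [.halt]

/-- Make the version in register `5` the last one, as a group end with the data in the
registers `0` and `18`. -/
def record : List Instr :=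
  [.store 15 5] ++ locate ++ [.load 14 6, .op .or 14 14 7, .store 6 14] ++ address ++
    [.store 8 0, .op .add 8 8 1, .store 8 18]

/-- Unmark the group end given by the registers `6`, `7` and `8`, and go to the preceding one. -/
def popEnd : List Instr :=
  [.load 14 6, .op .xor 14 14 7, .store 6 14, .op .add 8 8 1, .load 5 8]

def removeProgram (c : ℕ) : Program :=
  setup c ++ [.op .sub 10 10 0, .copy 5 10] ++ findEnd 9 ++
    [.load 0 8, .op .add 8 8 1, .load 18 8] ++ record ++ [.halt]

def addProgram (c : ℕ) : Program :=
  setup c ++ [.copy 5 10] ++ locate ++ address ++ [.load 13 8] ++ [.jumpLt 0 13 46] ++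
    [.copy 18 5, .op .add 5 10 1] ++ record ++ [.halt] ++ popEnd ++ [.jump 8]

/-- The registers hold the constants and the parameters of the layout. -/
structure Ready (c w M : ℕ) (r : ℕ → BitVec w) : Prop where
  r1 : r 1 = BitVec.ofNat w 1
  r2 : r 2 = BitVec.ofNat w 2
  r3 : r 3 = BitVec.ofNat w 3
  r4 : r 4 = BitVec.ofNat w (c + 4)
  r11 : r 11 = BitVec.ofNat w w
  r12 : r 12 = BitVec.ofNat w M
  r15 : r 15 = BitVec.ofNat w 0

variable {c w M S : ℕ} {r : ℕ → BitVec w} {m : Memory w S}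

theorem Ready.congr {r' : ℕ → BitVec w} (h : Ready c w M r)
    (hr : ∀ i ∈ [1, 2, 3, 4, 11, 12, 15], r' i = r i) : Ready c w M r' := by
  obtain ⟨h1, h2, h3, h4, h5, h6, h7⟩ := h
  simp only [List.mem_cons, List.not_mem_nil, or_false, forall_eq_or_imp, forall_eq] at hr
  obtain ⟨k1, k2, k3, k4, k5, k6, k7⟩ := hr
  constructor <;> simp only [*]

theorem toNat_ofNat_of_lt {n : ℕ} (hn : n < 2 ^ w) : (BitVec.ofNat w n).toNat = n := by
  rw [BitVec.toNat_ofNat, Nat.mod_eq_of_lt hn]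

namespace Layout

variable (hl : Layout c w M S)
include hl

theorem lt_pow {a : ℕ} (ha : a < S) : a < 2 ^ w := ha.trans_le hl.S_le

theorem block_setup {n : ℕ} (h0 : m.get 0 = BitVec.ofNat w n) (h1 : m.get 1 = BitVec.ofNat w w)
    (h2 : m.get 2 = BitVec.ofNat w M) (hr : r 15 = BitVec.ofNat w 0) :
    Block (setup c) r m fun r' m' => m' = m ∧ Ready c w M r' ∧ r' 10 = BitVec.ofNat w n ∧
      r' 0 = r 0 := by
  have h3 : 3 < S := hl.word_lt (Nat.zero_le c)
  have t0 := toNat_ofNat_of_lt (hl.lt_pow (show 0 < S by omega))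
  have t1 := toNat_ofNat_of_lt (hl.lt_pow (show 1 < S by omega))
  have t2 := toNat_ofNat_of_lt (hl.lt_pow (show 2 < S by omega))
  have g0 : 0 < S := by omega
  have g1 : 1 < S := by omega
  have g2 : 2 < S := by omega
  simp only [setup, Block, Function.update_apply, Nat.reduceEqDiff, reduceIte, hr, t0, t1, t2,
    h0, h1, h2, g0, g1, g2, true_and, and_true, OfNat.ofNat_ne_one, OfNat.zero_ne_ofNat]
  constructor <;> simp only [Function.update_apply, Nat.reduceEqDiff, reduceIte, hr]

theorem block_locate {u : ℕ} (hr : Ready c w M r) (hu : u ≤ c * w)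
    (h5 : r 5 = BitVec.ofNat w u) :
    Block locate r m fun r' m' => m' = m ∧ r' 6 = BitVec.ofNat w (3 + u / w) ∧
      r' 7 = BitVec.ofNat w (2 ^ (u % w)) ∧ ∀ i, i ≠ 6 → i ≠ 7 → r' i = r i := by
  obtain ⟨k1, k2, k3, k4, k11, k12, k15⟩ := hr
  have hu' : u < 2 ^ w := hu.trans_lt hl.cw_lt
  have e1 := BitVec.ofNat_div_ofNat (w := w) hu' Nat.lt_two_pow_self
  have e2 : BitVec.ofNat w u - BitVec.ofNat w (u / w * w) = BitVec.ofNat w (u % w) := by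
    rw [BitVec.ofNat_sub_ofNat_of_le _ _ ((Nat.div_mul_le_self u w).trans_lt hu')
      (Nat.div_mul_le_self u w)]
    congr 1
    have := Nat.div_add_mod' u w
    omega
  have e3 := BitVec.one_shiftLeft_ofNat (hl.mod_lt u)
  simp only [locate, Block, BinOp.eval, Function.update_apply, Nat.reduceEqDiff, reduceIte, k1,
    k3, k11, h5, e1, ← BitVec.ofNat_mul, e2, e3, ← BitVec.ofNat_add, add_comm, true_and]
  intro i h6 h7
  simp only [h6, h7, if_false]

theorem block_address {q k : ℕ} (hr : Ready c w M r) (hq : q ≤ c) (hk : k < w)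
    (h6 : r 6 = BitVec.ofNat w (3 + q)) (h7 : r 7 = BitVec.ofNat w (2 ^ k)) :
    Block address r m fun r' m' => m' = m ∧ r' 8 = BitVec.ofNat w (slot c M q k) ∧
      ∀ i, i ≠ 8 → i ≠ 9 → r' i = r i := by
  obtain ⟨k1, k2, k3, k4, k11, k12, k15⟩ := hr
  have hM : M < 2 ^ w := by
    have h1 := hl.size
    have h2 := hl.S_le
    rw [add_mul] at h1
    omega
  have hk' : 2 ^ k < 2 ^ w := Nat.pow_lt_pow_right (by norm_num) hk
  have e0 : BitVec.ofNat w (3 + q) - BitVec.ofNat w 3 = BitVec.ofNat w q := by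
    rw [BitVec.ofNat_sub_ofNat_of_le _ _ (hl.lt_pow (hl.word_lt (Nat.zero_le c))) (by omega)]
    simp
  have e1 := BitVec.ofNat_div_ofNat hk' hM
  have e2 : BitVec.ofNat w (2 ^ k) - BitVec.ofNat w (2 ^ k / M * M) =
      BitVec.ofNat w (2 ^ k % M) := by
    rw [BitVec.ofNat_sub_ofNat_of_le _ _ ((Nat.div_mul_le_self _ M).trans_lt hk')
      (Nat.div_mul_le_self _ M)]
    congr 1
    have := Nat.div_add_mod' (2 ^ k) M
    omega
  have e3 : (q * M + 2 ^ k % M) * 2 + (c + 4) = slot c M q k := by unfold slot; ring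
  simp only [address, Block, BinOp.eval, Function.update_apply, Nat.reduceEqDiff, reduceIte, k2,
    k3, k4, k12, h6, h7, e0, e1, ← BitVec.ofNat_mul, e2, ← BitVec.ofNat_add, e3, true_and]
  intro i h8 h9
  simp only [h8, h9, if_false]

end Layout

end VersionBoundary

/-! ### Searching for the group end of a version. -/

namespace WordRAM

theorem prefix_append_drop {P A B : List Instr} {p : ℕ} (h : A ++ B <+: P.drop p) :
    A <+: P.drop p ∧ B <+: P.drop (p + A.length) := by
  obtain ⟨l, hl⟩ := h
  refine ⟨⟨B ++ l, by rw [← hl, List.append_assoc]⟩, ⟨l, ?_⟩⟩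
  have := congrArg (List.drop A.length) hl
  simpa [List.drop_drop, List.append_assoc] using this

theorem getElem?_of_singleton_prefix {P : List Instr} {i : Instr} {p : ℕ}
    (h : [i] <+: P.drop p) : P[p]? = some i := by
  obtain ⟨l, hl⟩ := h
  have := congrArg (fun l => l[0]?) hl
  simpa using this.symm

end WordRAM

namespace VersionBoundary

open WordRAM

variable {c w M S : ℕ} {r : ℕ → BitVec w} {m : Memory w S}

theorem isEnd_mul_add {q k : ℕ} (hk : k < w) :
    isEnd m (q * w + k) = (m.get (3 + q)).getLsbD k := by
  have hw : 0 < w := by omega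
  rw [isEnd, mul_comm, Nat.mul_add_div hw, Nat.div_eq_of_lt hk, Nat.mul_add_mod,
    Nat.mod_eq_of_lt hk, add_zero]

namespace Layout

variable (hl : Layout c w M S)
include hl

theorem block_maskWord {q k : ℕ} (hr : Ready c w M r) (hq : q ≤ c)
    (h6 : r 6 = BitVec.ofNat w (3 + q)) (h7 : r 7 = BitVec.ofNat w (2 ^ k)) :
    Block maskWord r m fun r' m' => m' = m ∧
      r' 14 = m.get (3 + q) &&& (0#w - BitVec.ofNat w (2 ^ k)) ∧
      ∀ i, i ≠ 13 → i ≠ 14 → r' i = r i := by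
  have h1 := hl.word_lt hq
  have t1 := toNat_ofNat_of_lt (hl.lt_pow h1)
  simp only [maskWord, Block, BinOp.eval, Function.update_apply, Nat.reduceEqDiff, reduceIte,
    hr.r15, h6, h7, t1, h1, true_and]
  intro i h8 h9
  simp only [h8, h9, if_false]

theorem block_nextWord {q : ℕ} (hr : Ready c w M r) (hq : q + 1 ≤ c)
    (h6 : r 6 = BitVec.ofNat w (3 + q)) :
    Block nextWord r m fun r' m' => m' = m ∧ r' 6 = BitVec.ofNat w (3 + (q + 1)) ∧
      r' 14 = m.get (3 + (q + 1)) ∧ ∀ i, i ≠ 6 → i ≠ 14 → r' i = r i := by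
  have h1 := hl.word_lt hq
  have t1 := toNat_ofNat_of_lt (hl.lt_pow h1)
  simp only [nextWord, Block, BinOp.eval, Function.update_apply, Nat.reduceEqDiff, reduceIte,
    hr.r1, h6, ← BitVec.ofNat_add, add_assoc, t1, h1, true_and]
  intro i h8 h9
  simp only [h8, h9, if_false]

omit hl in
theorem block_lowestBit {k : ℕ} (hr : Ready c w M r) (hk : (r 14).getLsbD k = true)
    (hlt : ∀ i < k, (r 14).getLsbD i = false) :
    Block lowestBit r m fun r' m' => m' = m ∧ r' 7 = BitVec.ofNat w (2 ^ k) ∧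
      ∀ i, i ≠ 7 → i ≠ 13 → r' i = r i := by
  have h1 := BitVec.and_neg_eq hk hlt
  simp only [lowestBit, Block, BinOp.eval, Function.update_apply, Nat.reduceEqDiff, reduceIte,
    hr.r15, h1, true_and]
  intro i h8 h9
  simp only [h8, h9, if_false]

variable {P : Program} {p u v : ℕ} {Q : ℕ → Memory w S → BitVec w → Prop}

/-- Invariant of the scan: register 14 holds mark word `q` without the versions below `u`, and there
is no mark from `u` up to this word. The number `d` of words left before that of `v` decreases. The
mark at `v` stops the scan before any stale mark matters. -/
theorem ends_findEnd_loop (hp : findEnd p <+: P.drop p) (huv : u ≤ v) (hv : v ≤ c * w)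
    (hve : isEnd m v = true)
    (h : ∀ e r' t, u ≤ e → e ≤ v → isEnd m e = true →
      (∀ k, u ≤ k → k < e → isEnd m k = false) → t ≤ 4 * c + 11 →
      r' 8 = BitVec.ofNat w (dataAddr c w M e) →
      (∀ i, i ∉ [6, 7, 8, 9, 13, 14] → r' i = r i) →
      Ends P ⟨p + 22, r', m⟩ fun s => Q (s + t))
    -- A skipped word costs 4 steps: the test, two instructions of `nextWord` and the jump back.
    {d q t₀ : ℕ} (hd : q + d = v / w) (ht : t₀ + 4 * d ≤ 4 * c) {r₁ : ℕ → BitVec w}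
    (hr : Ready c w M r₁) (hr₁ : ∀ i, i ∉ [6, 7, 8, 9, 13, 14] → r₁ i = r i)
    (h6 : r₁ 6 = BitVec.ofNat w (3 + q))
    (huq : u < (q + 1) * w)
    (hx : ∀ k < w, (r₁ 14).getLsbD k = (decide (u ≤ q * w + k) && isEnd m (q * w + k)))
    (hno : ∀ k, u ≤ k → k < q * w → isEnd m k = false) :
    Ends P ⟨p + 8, r₁, m⟩ fun s => Q (s + t₀) := by
  obtain ⟨hp, hp7⟩ := prefix_append_drop hp
  obtain ⟨hp, hp6⟩ := prefix_append_drop hp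
  obtain ⟨hp, hp5⟩ := prefix_append_drop hp
  obtain ⟨hp, hp4⟩ := prefix_append_drop hp
  obtain ⟨hp, hp3⟩ := prefix_append_drop hp
  induction d using Nat.strong_induction_on generalizing q t₀ r₁ with
  | _ d ih =>
  have hvc : v / w ≤ c := div_le hv
  have hq : q ≤ c := by omega
  have h15 : (r₁ 15).toNat = 0 := by simp [hr.r15]
  have hvw := Nat.div_add_mod' v w
  have hvm := hl.mod_lt v
  by_cases hx0 : r₁ 14 = 0#w
  -- In the word of `v` the mark of `v` itself survives the mask, so that word cannot be zero.
  · have hd0 : d ≠ 0 := by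
      rintro rfl
      have := hx (v % w) hvm
      rw [hx0, ← Nat.add_zero q, hd, hvw, hve] at this
      simp [huv] at this
    obtain ⟨d, rfl⟩ := Nat.exists_eq_succ_of_ne_zero hd0
    refine .jumpLt_neg (getElem?_of_singleton_prefix hp3) (by simp [hx0]) ?_
    refine Block.ends (p := p + 8 + 1) hp4 ?_
    refine (hl.block_nextWord hr (by omega) h6).mono ?_
    rintro r₂ _ ⟨rfl, k1, k2, k3⟩
    refine .jump (getElem?_of_singleton_prefix hp5) ?_
    have hadd : (q + 1) * w = q * w + w := by ring
    refine (ih d (by omega) (q := q + 1) (t₀ := t₀ + 4) (by omega) (by omega)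
      (hr.congr ?_) ?_ k1 ?_ ?_ ?_).mono ?_
    · simp +contextual [k3]
    · intro i hi
      obtain ⟨i6, i7, i8, i9, i13, i14⟩ :
          i ≠ 6 ∧ i ≠ 7 ∧ i ≠ 8 ∧ i ≠ 9 ∧ i ≠ 13 ∧ i ≠ 14 := by simpa using hi
      rw [k3 i i6 i14, hr₁ i hi]
    · have : (q + 1 + 1) * w = (q + 1) * w + w := by ring
      omega
    · intro k hk
      rw [k2, isEnd_mul_add hk]
      have : u ≤ (q + 1) * w + k := by omega
      simp [this]
    · intro k hk hk'
      by_cases hkq : k < q * w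
      · exact hno k hk hkq
      · have := hx (k - q * w) (by omega)
        rw [hx0, Nat.add_sub_cancel' (by omega)] at this
        simpa [hk] using this.symm
    · intro t m' y hQ
      simp only [nextWord, List.length_cons, List.length_nil]
      convert hQ using 1
      ring
  -- The index of the lowest bit is only named in the proof; the program computes `2 ^ k`, never
  -- `k`.
  · have hk := BitVec.getLsbD_true_ctz_of_ne_zero hx0
    have hlt : ∀ i < (r₁ 14).ctz.toNat, (r₁ 14).getLsbD i = false :=
      fun i hi => BitVec.getLsbD_false_of_lt_ctz hi
    generalize (r₁ 14).ctz.toNat = k at hk hlt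
    have hkw : k < w := BitVec.lt_of_getLsbD hk
    have hk' := hx k hkw
    rw [hk] at hk'
    obtain ⟨hu, he⟩ : u ≤ q * w + k ∧ isEnd m (q * w + k) = true := by simpa using hk'.symm
    have hno' : ∀ i, u ≤ i → i < q * w + k → isEnd m i = false := by
      intro i hi hi'
      by_cases hiq : i < q * w
      · exact hno i hi hiq
      · have := hx (i - q * w) (by omega)
        rw [hlt _ (by omega), Nat.add_sub_cancel' (by omega)] at this
        simpa [hi] using this.symm
    have hev : q * w + k ≤ v := by
      by_contra hc
      rw [hno' v huv (by omega)] at hve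
      simp at hve
    have hpos : (r₁ 15).toNat < (r₁ 14).toNat := by
      rw [h15, Nat.pos_iff_ne_zero]
      exact fun h0 => hx0 (BitVec.eq_of_toNat_eq (by simpa using h0))
    refine .jumpLt_pos (getElem?_of_singleton_prefix hp3) hpos ?_
    refine Block.ends hp6 ?_
    refine (block_lowestBit hr hk hlt).mono ?_
    rintro r₂ _ ⟨rfl, k1, k2⟩
    refine Block.ends hp7 ?_
    have hr2 : Ready c w M r₂ := hr.congr (by simp +contextual [k2])
    refine (hl.block_address hr2 hq hkw (by rw [k2 6 (by simp) (by simp), h6]) k1).mono ?_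
    rintro r₃ _ ⟨rfl, k3, k4⟩
    -- The final 11 steps are the test, two for `lowestBit` and eight for `address`.
    refine (h (q * w + k) r₃ (t₀ + 11) hu hev he hno' (by omega) ?_ ?_).mono ?_
    · rw [k3, dataAddr, mul_comm, Nat.mul_add_div hl.w_pos, Nat.div_eq_of_lt hkw,
        Nat.mul_add_mod, Nat.mod_eq_of_lt hkw, add_zero]
    · intro i hi
      obtain ⟨i6, i7, i8, i9, i13, i14⟩ :
          i ≠ 6 ∧ i ≠ 7 ∧ i ≠ 8 ∧ i ≠ 9 ∧ i ≠ 13 ∧ i ≠ 14 := by simpa using hi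
      rw [k4 i i8 i9, k2 i i7 i13, hr₁ i hi]
    · intro t m' y hQ
      simp only [lowestBit, address, List.length_cons, List.length_nil]
      convert hQ using 1
      ring

/-- The code `findEnd` computes the data address of the group end of a version. -/
theorem ends_findEnd (hp : findEnd p <+: P.drop p) (huv : u ≤ v) (hv : v ≤ c * w)
    (hve : isEnd m v = true) (hr : Ready c w M r) (h5 : r 5 = BitVec.ofNat w u)
    (h : ∀ e r' t, u ≤ e → e ≤ v → isEnd m e = true →
      (∀ k, u ≤ k → k < e → isEnd m k = false) → t ≤ 4 * c + 19 →
      r' 8 = BitVec.ofNat w (dataAddr c w M e) →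
      (∀ i, i ∉ [6, 7, 8, 9, 13, 14] → r' i = r i) →
      Ends P ⟨p + 22, r', m⟩ fun s => Q (s + t)) :
    Ends P ⟨p, r, m⟩ Q := by
  have hloop := hp
  obtain ⟨hp, -⟩ := prefix_append_drop hp
  obtain ⟨hp, -⟩ := prefix_append_drop hp
  obtain ⟨hp, -⟩ := prefix_append_drop hp
  obtain ⟨hp, -⟩ := prefix_append_drop hp
  obtain ⟨hp, -⟩ := prefix_append_drop hp
  obtain ⟨hp, hp2⟩ := prefix_append_drop hp
  have huc := div_le (huv.trans hv)
  refine Block.ends hp ?_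
  refine (hl.block_locate hr (huv.trans hv) h5).mono ?_
  rintro r₁ _ ⟨rfl, k1, k2, k3⟩
  refine Block.ends hp2 ?_
  have hr1 : Ready c w M r₁ := hr.congr (by simp +contextual [k3])
  refine (hl.block_maskWord hr1 huc k1 k2).mono ?_
  rintro r₂ _ ⟨rfl, k4, k5⟩
  have huw := Nat.div_add_mod' u w
  have hum := hl.mod_lt u
  have hdiv : u / w ≤ v / w := Nat.div_le_div_right huv
  have hvc : v / w ≤ c := div_le hv
  refine (hl.ends_findEnd_loop (r := r) (Q := fun s => Q (s + 8)) hloop huv hv hve ?_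
    (d := v / w - u / w) (q := u / w)
    (t₀ := 0) (Nat.add_sub_cancel' hdiv) (by have := Nat.sub_le (v / w) (u / w); omega) (hr1.congr (by simp +contextual [k5])) ?_ ?_ ?_ ?_
    ?_).mono ?_
  · intro e r' t h1 h2 h3 h4 h5 h6 h7
    exact (h e r' (t + 8) h1 h2 h3 h4 (by omega) h6 h7)
  · intro i hi
    obtain ⟨i6, i7, i8, i9, i13, i14⟩ :
        i ≠ 6 ∧ i ≠ 7 ∧ i ≠ 8 ∧ i ≠ 9 ∧ i ≠ 13 ∧ i ≠ 14 := by simpa using hi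
    rw [k5 i i13 i14, k3 i i6 i7]
  · rw [k5 6 (by simp) (by simp), k1]
  · rw [add_mul]; omega
  · intro k hk
    rw [k4, BitVec.getLsbD_and, isEnd_mul_add hk, BitVec.getLsbD_neg_two_pow hum hk, Bool.and_comm]
    congr 2
    simp only [eq_iff_iff]
    omega
  · intro k hk hk'
    omega
  · intro t m' y hQ
    exact hQ

end Layout

end VersionBoundary

/-! ### Recording a new last version, and the query. -/

namespace VersionBoundary

open WordRAM

variable {c w M S : ℕ} {r : ℕ → BitVec w} {m : Memory w S}

/-- Make `u` the last version, as a group end with the data `x` and `y`. -/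
def setTop (c M : ℕ) (m : Memory w S) (u : ℕ) (x y : BitVec w) : Memory w S :=
  let m₁ := m.put 0 (BitVec.ofNat w u)
  let m₂ := m₁.put (3 + u / w) (m₁.get (3 + u / w) ||| BitVec.ofNat w (2 ^ (u % w)))
  (m₂.put (dataAddr c w M u) x).put (dataAddr c w M u + 1) y

namespace Layout

variable (hl : Layout c w M S)
include hl

theorem isEnd_setTop (m : Memory w S) {u : ℕ} (hu : u ≤ c * w) (x y : BitVec w) {i : ℕ}
    (hi : i ≤ c * w) : isEnd (setTop c M m u x y) i = (isEnd m i || decide (i = u)) := by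
  have h1 := hl.dataAddr_lt hu
  have h2 := lt_dataAddr (c := c) (w := w) (M := M) u
  rw [setTop, isEnd_put_data _ hi (by omega) h1, isEnd_put_data _ hi h2 (by omega),
    hl.isEnd_set _ hu, hl.isEnd_put_version]

theorem get_setTop (m : Memory w S) {u : ℕ} (hu : u ≤ c * w) (x y : BitVec w) {a : ℕ}
    (h0 : a ≠ 0) (h3 : a < 3 ∨ c + 3 < a) (hd : a ≠ dataAddr c w M u)
    (hd' : a ≠ dataAddr c w M u + 1) : (setTop c M m u x y).get a = m.get a := by
  have h1 := hl.dataAddr_lt hu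
  have h2 := hl.word_lt (div_le hu)
  have h4 := div_le hu
  have h6 := Nat.le_add_right 3 (u / w)
  have h5 : a ≠ 3 + u / w := by omega
  rw [setTop, Memory.get_put _ h1, if_neg hd', Memory.get_put _ (by omega), if_neg hd,
    Memory.get_put _ h2, if_neg h5, Memory.get_put (a := 0) _ (by omega), if_neg h0]

theorem get_setTop_zero (m : Memory w S) {u : ℕ} (hu : u ≤ c * w) (x y : BitVec w) :
    (setTop c M m u x y).get 0 = BitVec.ofNat w u := by
  have h1 := hl.dataAddr_lt hu
  have h2 := hl.word_lt (div_le hu)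
  have h3 := lt_dataAddr (c := c) (w := w) (M := M) u
  have h6 := Nat.le_add_right 3 (u / w)
  have h5 : 0 ≠ 3 + u / w := by omega
  rw [setTop, Memory.get_put _ h1, if_neg (by omega), Memory.get_put _ (by omega),
    if_neg (by omega), Memory.get_put _ h2, if_neg h5, Memory.get_put (a := 0) _ (by omega),
    if_pos rfl]

theorem get_setTop_val (m : Memory w S) {u : ℕ} (hu : u ≤ c * w) (x y : BitVec w) :
    (setTop c M m u x y).get (dataAddr c w M u) = x := by
  have h1 := hl.dataAddr_lt hu
  rw [setTop, Memory.get_put _ h1, if_neg (by omega), Memory.get_put _ (by omega), if_pos rfl]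

theorem get_setTop_link (m : Memory w S) {u : ℕ} (hu : u ≤ c * w) (x y : BitVec w) :
    (setTop c M m u x y).get (dataAddr c w M u + 1) = y := by
  rw [setTop, Memory.get_put _ (hl.dataAddr_lt hu), if_pos rfl]

theorem get_setTop_val_ne (m : Memory w S) {u : ℕ} (hu : u ≤ c * w) (x y : BitVec w) {i : ℕ}
    (hi : i ≠ u) : (setTop c M m u x y).get (dataAddr c w M i) = m.get (dataAddr c w M i) := by
  have h3 := lt_dataAddr (c := c) (w := w) (M := M) i
  exact hl.get_setTop m hu x y (by omega) (.inr h3) (fun h => hi (hl.dataAddr_inj h))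
    (dataAddr_ne_succ _ _)

theorem get_setTop_link_ne (m : Memory w S) {u : ℕ} (hu : u ≤ c * w) (x y : BitVec w) {i : ℕ}
    (hi : i ≠ u) :
    (setTop c M m u x y).get (dataAddr c w M i + 1) = m.get (dataAddr c w M i + 1) := by
  have h3 := lt_dataAddr (c := c) (w := w) (M := M) i
  exact hl.get_setTop m hu x y (by omega) (.inr (by omega)) (dataAddr_ne_succ _ _).symm
    (fun h => hi (hl.dataAddr_inj (by omega)))

theorem block_record {u : ℕ} (hr : Ready c w M r) (hu : u ≤ c * w)
    (h5 : r 5 = BitVec.ofNat w u) :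
    Block record r m fun _ m' => m' = setTop c M m u (r 0) (r 18) := by
  have hq := div_le hu
  have h1 := hl.word_lt hq
  have h0 : 0 < S := (Nat.zero_le _).trans_lt h1
  have hd := hl.dataAddr_lt hu
  have t0 := toNat_ofNat_of_lt (hl.lt_pow h0)
  have t1 := toNat_ofNat_of_lt (hl.lt_pow h1)
  have t2 := toNat_ofNat_of_lt (hl.lt_pow hd)
  have t3 := toNat_ofNat_of_lt (hl.lt_pow (show dataAddr c w M u < S by omega))
  refine .append (.append (.append (.append ?_)))
  simp only [Block, hr.r15, t0, h0, h5, true_and]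
  refine (hl.block_locate hr hu h5).mono ?_
  rintro r₁ _ ⟨rfl, k1, k2, k3⟩
  simp only [BinOp.eval, Function.update_apply, Nat.reduceEqDiff, reduceIte, k1, k2, t1, h1, true_and]
  have hr2 : Ready c w M r₁ := hr.congr (by simp +contextual [k3])
  generalize hr₂ : Function.update (Function.update r₁ _ _) _ _ = r₂
  have k4 : ∀ i, i ≠ 14 → r₂ i = r₁ i := by
    intro i hi
    simp [← hr₂, hi]
  refine (hl.block_address (hr2.congr (by simp +contextual [k4])) hq (hl.mod_lt u)
    (by rw [k4 6 (by simp), k1]) (by rw [k4 7 (by simp), k2])).mono ?_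
  rintro r₃ _ ⟨rfl, k5, k6⟩
  have k1' : r₃ 1 = BitVec.ofNat w 1 := by
    rw [k6 1 (by simp) (by simp), k4 1 (by simp), hr2.r1]
  have k7 : ∀ i, 10 ≤ i ∧ i ≠ 14 ∨ i = 0 → r₃ i = r i := by
    intro i hi
    rw [k6 i (by omega) (by omega), k4 i (by omega), k3 i (by omega) (by omega)]
  rw [← dataAddr] at k5
  simp only [k5, k1', t2,
    t3, ← BitVec.ofNat_add, hd, (Nat.lt_succ_self _).trans hd, true_and,
    k7 0 (.inr rfl), k7 18 (.inl (by norm_num))]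
  rfl

end Layout

theorem minbound_spec (hl : Layout c w M S) {L : Bounds} (hm : Represents c M m L) {u : ℕ}
    (hu : u < 2 ^ w) :
    ∃ t y, Call (minboundProgram c) m (BitVec.ofNat w u) t m y ∧ t ≤ 4 * c + 30 ∧
      ∀ b, L.minbound u = some b → y.toNat = b := by
  suffices h : Ends (minboundProgram c)
      ⟨0, Function.update (fun _ => 0) 0 (BitVec.ofNat w u), m⟩ (fun t m' y => m' = m ∧
        t ≤ 4 * c + 30 ∧ ∀ b, L.minbound u = some b → y.toNat = b) by
    obtain ⟨t, _, y, h1, rfl, h2⟩ := h.call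
    exact ⟨t, y, h1, h2⟩
  have hL : L.length < 2 ^ w := hm.length_le.trans_lt hl.cw_lt
  refine Block.ends (B := setup c) ⟨_, rfl⟩ ?_
  refine (hl.block_setup hm.version hm.width hm.modulus (by simp)).mono ?_
  rintro r₁ _ ⟨rfl, hr, h10, h0⟩
  rw [Function.update_self] at h0
  by_cases hlt : L.length < u
  -- A query beyond the last version halts at once; otherwise the scan could run past the mark
  -- words.
  · refine .jumpLt_pos (l := 32) rfl ?_ (.halt rfl ?_)
    · rwa [h10, h0, toNat_ofNat_of_lt hL, toNat_ofNat_of_lt hu]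
    · refine ⟨rfl, by simp [setup], fun b hb => ?_⟩
      have := (Bounds.at_of_minbound hb).1
      omega
  · rw [not_lt] at hlt
    refine .jumpLt_neg (l := 32) rfl ?_ ?_
    · rw [h10, h0, toNat_ofNat_of_lt hL, toNat_ofNat_of_lt hu]
      omega
    refine Block.ends (B := [.copy 5 0]) ⟨_, rfl⟩ ?_
    simp only [Block]
    refine hl.ends_findEnd (p := 9) ⟨_, rfl⟩ hlt hm.length_le hm.chain.top
      (hr.congr (by simp)) (by simp [h0]) ?_
    intro e r₂ t h1 h2 h3 h4 ht h8 _
    have he := hl.dataAddr_lt (h2.trans hm.length_le)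
    have t1 := toNat_ofNat_of_lt (hl.lt_pow (show dataAddr c w M e < S by omega))
    refine Block.ends (p := 31) (B := [.load 0 8]) ⟨_, rfl⟩ ?_
    simp only [Block, h8, t1]
    refine ⟨by omega, .halt rfl ⟨rfl, ?_, fun b hb => ?_⟩⟩
    · simp [setup]
      omega
    · rw [Function.update_self, hm.chain.val e h2 h3, toNat_ofNat_of_lt (hm.lt e h2),
        ← hm.chain.eq_of_no_end h1 h2 h4, (Bounds.at_of_minbound hb).2]

end VersionBoundary

/-! ### Removal and amortized insertion. -/

namespace VersionBoundary

open WordRAM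

variable {c w M S : ℕ} {m : Memory w S}

theorem remove_spec (hl : Layout c w M S) {L : Bounds} (hm : Represents c M m L) {j : ℕ}
    (hj : j ≤ L.length) :
    ∃ t m' y, Call (removeProgram c) m (BitVec.ofNat w j) t m' y ∧ t ≤ 4 * c + 60 ∧
      Represents c M m' (L.remove j) ∧
      numEnds m' (L.remove j).length ≤ numEnds m L.length := by
  suffices h : Ends (removeProgram c)
      ⟨0, Function.update (fun _ => 0) 0 (BitVec.ofNat w j), m⟩ (fun t m' _ => t ≤ 4 * c + 60 ∧
        Represents c M m' (L.remove j) ∧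
        numEnds m' (L.remove j).length ≤ numEnds m L.length) from h.call
  have hL : L.length < 2 ^ w := hm.length_le.trans_lt hl.cw_lt
  refine Block.ends (B := setup c) ⟨_, rfl⟩ ?_
  refine (hl.block_setup hm.version hm.width hm.modulus (by simp)).mono ?_
  rintro r₁ _ ⟨rfl, hr, h10, h0⟩
  rw [Function.update_self] at h0
  have e1 := BitVec.ofNat_sub_ofNat_of_le (w := w) _ _ (hj.trans_lt hL) hj
  have hv : L.length - j ≤ c * w := (Nat.sub_le _ _).trans hm.length_le
  refine Block.ends (B := [.op .sub 10 10 0, .copy 5 10]) ⟨_, rfl⟩ ?_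
  simp only [Block, BinOp.eval, h10, h0, e1]
  refine hl.ends_findEnd (p := 9) ⟨_, rfl⟩ (Nat.sub_le _ j) hm.length_le hm.chain.top
    (hr.congr (by simp)) (by simp) ?_
  intro e r₂ t h1 h2 h3 h4 ht h8 hr₂
  have he := hl.dataAddr_lt (h2.trans hm.length_le)
  have t1 := toNat_ofNat_of_lt (hl.lt_pow (show dataAddr c w M e < S by omega))
  have t2 := toNat_ofNat_of_lt (hl.lt_pow he)
  have k1 : r₂ 1 = BitVec.ofNat w 1 := by simp [hr₂, hr.r1]
  refine Block.ends (p := 31) (B := [.load 0 8, .op .add 8 8 1, .load 18 8]) ⟨_, rfl⟩ ?_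
  simp only [Block, BinOp.eval, Function.update_apply, OfNat.ofNat_ne_zero,
    one_ne_zero, reduceIte, h8, t1, k1, ← BitVec.ofNat_add, t2, he,
    (Nat.lt_succ_self _).trans he, true_and]
  refine Block.ends (p := 34) (B := record) ⟨_, rfl⟩ ?_
  refine (hl.block_record (u := L.length - j) (hr.congr (by simp [hr₂])) hv
    (by simp [hr₂])).mono ?_
  rintro r₃ _ rfl
  refine .halt rfl ⟨?_, ?_, ?_⟩
  · simp [setup, record, locate, address]
    omega
  · simp only [Function.update_self, ne_eq, OfNat.zero_ne_ofNat, not_false_eq_true,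
      Function.update_of_ne]
    have hlt := Layout.lt_dataAddr (c := c) (w := w) (M := M) (L.length - j)
    constructor
    · rw [hl.get_setTop_zero _ hv, Bounds.length_remove]
    · rw [hl.get_setTop _ hv _ _ (by omega) (by omega) (by omega) (by omega), hm.width]
    · rw [hl.get_setTop _ hv _ _ (by omega) (by omega) (by omega) (by omega), hm.modulus]
    · rwa [Bounds.length_remove]
    · intro i hi
      rw [Bounds.length_remove] at hi
      rw [Bounds.at_remove _ hi]
      exact hm.lt i (by omega)
    · intro i k hik hk
      rw [Bounds.length_remove] at hk
      rw [Bounds.at_remove _ hk, Bounds.at_remove _ (hik.trans hk)]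
      exact hm.mono i k hik (by omega)
    · rw [Bounds.length_remove]
      -- Only versions up to the new last one matter here, so the marks above it need not be erased.
      exact hm.chain.truncate h1 h2 h3 h4
        (fun i hi => hl.isEnd_setTop _ hv _ _ (hi.trans hv))
        (fun i hi => Bounds.at_remove _ hi)
        (fun i hi => hl.get_setTop_val_ne _ hv _ _ hi.ne)
        (fun i hi => hl.get_setTop_link_ne _ hv _ _ hi.ne)
        (hl.get_setTop_val _ hv _ _) (hl.get_setTop_link _ hv _ _)
  · rw [Bounds.length_remove]
    exact numEnds_truncate h1 h2 h3 fun i hi => hl.isEnd_setTop _ hv _ _ (hi.trans hv)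

/-- The loop that pops the group ends with larger boundaries, followed by the insertion of the
new version. -/
theorem ends_add_loop (hl : Layout c w M S) {L : Bounds} {n e : ℕ} (hn : n < 2 ^ w)
    (hL : L.length + 1 ≤ c * w) (hlt : ∀ i ≤ L.length, L.at i < 2 ^ w)
    (hmono : ∀ i j, i ≤ j → j ≤ L.length → L.at i ≤ L.at j)
    (heL : e ≤ L.length) {r : ℕ → BitVec w} (hr : Ready c w M r)
    (h0 : r 0 = BitVec.ofNat w n) (h5 : r 5 = BitVec.ofNat w e)
    (h10 : r 10 = BitVec.ofNat w L.length)
    (h1 : m.get 1 = BitVec.ofNat w w) (h2 : m.get 2 = BitVec.ofNat w M)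
    (hc : Chain c M m L.at e) (hno : ∀ i, e < i → i ≤ L.length → isEnd m i = false)
    (hB : ∀ i, e < i → i ≤ L.length → n < L.at i) :
    Ends (addProgram c) ⟨8, r, m⟩ fun t m' _ => Represents c M m' (L.add n) ∧
      t + 21 * numEnds m' (L.add n).length ≤ 21 * numEnds m L.length + 60 := by
  induction e using Nat.strong_induction_on generalizing m r with
  | _ e ih =>
  have hec : e ≤ c * w := by omega
  have he := hl.dataAddr_lt hec
  have hq := Layout.div_le hec
  have t1 := toNat_ofNat_of_lt (hl.lt_pow (show dataAddr c w M e < S by omega))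
  have t2 := toNat_ofNat_of_lt (hl.lt_pow he)
  have t3 := toNat_ofNat_of_lt (hl.lt_pow (hl.word_lt hq))
  have hda := Layout.lt_dataAddr (c := c) (w := w) (M := M) e
  refine Block.ends (B := locate) ⟨_, rfl⟩ ?_
  refine (hl.block_locate hr hec h5).mono ?_
  rintro r₁ m ⟨rfl, k1, k2, k3⟩
  have hr1 : Ready c w M r₁ := hr.congr (by simp +contextual [k3])
  refine Block.ends (p := 13) (B := address) ⟨_, rfl⟩ ?_
  refine (hl.block_address hr1 hq (hl.mod_lt e) k1 k2).mono ?_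
  rintro r₂ m ⟨rfl, k4, k5⟩
  have hr2 : Ready c w M r₂ := hr1.congr (by simp +contextual [k5])
  have k6 : ∀ i, i < 6 ∨ 9 < i → r₂ i = r i := by
    intro i hi
    rw [k5 i (by omega) (by omega), k3 i (by omega) (by omega)]
  rw [← dataAddr] at k4
  refine Block.ends (p := 21) (B := [.load 13 8]) ⟨_, rfl⟩ ?_
  simp only [Block, k4, t1, (Nat.lt_succ_self _).trans he, true_and]
  rw [hc.val e le_rfl hc.top]
  by_cases hcmp : n < L.at e
  -- The sentinel has boundary `0`, which is never above `n`, so it is never popped.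
  · have he0 : 0 < e := by
      rw [Nat.pos_iff_ne_zero]
      rintro rfl
      simp [Bounds.at] at hcmp
    obtain ⟨p, hpe, hp, hlink, hpno⟩ := hc.link e le_rfl he0 hc.top
    refine .jumpLt_pos (p := 22) (l := 46) rfl ?_ ?_
    · simp only [Function.update_self, ne_eq, OfNat.zero_ne_ofNat, not_false_eq_true,
        Function.update_of_ne, k6 0 (by omega), h0]
      rwa [toNat_ofNat_of_lt hn, toNat_ofNat_of_lt (hlt e heL)]
    refine Block.ends (p := 46) (B := popEnd) ⟨_, rfl⟩ ?_
    have k61 : r₂ 6 = BitVec.ofNat w (3 + e / w) := by rw [k5 6 (by simp) (by simp), k1]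
    have k71 : r₂ 7 = BitVec.ofNat w (2 ^ (e % w)) := by rw [k5 7 (by simp) (by simp), k2]
    simp only [popEnd, Block, BinOp.eval, Function.update_apply, Nat.reduceEqDiff,
      OfNat.one_ne_ofNat, reduceIte, k61, k71, t3, k4, hr2.r1, ← BitVec.ofNat_add, t2, he,
      hl.word_lt hq, true_and]
    generalize hm₁ : m.put (3 + e / w) (m.get (3 + e / w) ^^^ BitVec.ofNat w (2 ^ (e % w))) = m₁
    have hend : ∀ i, isEnd m₁ i = (isEnd m i ^^ decide (i = e)) := by
      intro i
      rw [← hm₁, hl.isEnd_flip m hec]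
    have hget : ∀ a, a < 3 ∨ c + 3 < a → m₁.get a = m.get a := by
      intro a ha
      have h6 := Nat.le_add_right 3 (e / w)
      have h7 : a ≠ 3 + e / w := by omega
      rw [← hm₁, Memory.get_put _ (hl.word_lt hq), if_neg h7]
    have hget' : ∀ i, m₁.get (dataAddr c w M i) = m.get (dataAddr c w M i) ∧
        m₁.get (dataAddr c w M i + 1) = m.get (dataAddr c w M i + 1) := by
      intro i
      have := Layout.lt_dataAddr (c := c) (w := w) (M := M) i
      exact ⟨hget _ (by omega), hget _ (by omega)⟩
    have hcard := numEnds_flip (m' := m₁) hc.top he0 heL fun i _ => hend i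
    refine .jump (p := 51) rfl ?_
    refine (ih p hpe (by omega) (hr2.congr (by simp)) (by simp [k6, h0])
      (by simp [(hget' e).2, hlink]) (by simp [k6, h10])
      (by rw [hget _ (by omega), h1]) (by rw [hget _ (by omega), h2])
      ((hc.of_le hpe.le hp).congr ?_ (fun _ _ => rfl) (fun i _ => (hget' i).1)
        (fun i _ => (hget' i).2)) ?_ ?_).mono ?_
    · intro i hi
      have : i ≠ e := by omega
      simp [hend, this]
    · intro i hi hi'
      rcases lt_trichotomy i e with h | rfl | h
      · simp [hend, hpno i hi h, h.ne]
      · simp [hend, hc.top]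
      · simp [hend, hno i h hi', h.ne']
    -- The versions after `p` up to `e` form one group, so they all share the too large boundary of
    -- `e`.
    · intro i hi hi'
      by_cases h : e < i
      · exact hB i h hi'
      · rwa [hc.eq_of_no_end (u := i) (by omega) le_rfl fun k hk hk' => hpno k (by omega) hk']
    · rintro t m' - ⟨g1, g2⟩
      refine ⟨g1, ?_⟩
      simp only [locate, address, List.length_cons, List.length_nil]
      -- One pop costs 21 = 5 + 8 + 1 + 1 + 5 + 1 steps (`locate`, `address`, load, test, `popEnd`,
      -- jump), exactly what the lost unit of potential pays.
      omega
  · refine .jumpLt_neg (p := 22) (l := 46) rfl ?_ ?_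
    · simp only [Function.update_self, ne_eq, OfNat.zero_ne_ofNat, not_false_eq_true,
        Function.update_of_ne, k6 0 (by omega), h0]
      rwa [toNat_ofNat_of_lt hn, toNat_ofNat_of_lt (hlt e heL)]
    rw [not_lt] at hcmp
    refine Block.ends (p := 23) (B := [.copy 18 5, .op .add 5 10 1]) ⟨_, rfl⟩ ?_
    simp only [Block, BinOp.eval, Function.update_apply, Nat.reduceEqDiff, OfNat.one_ne_ofNat,
      reduceIte, k6 10 (by omega), k6 5 (by omega), h5, h10, hr2.r1, ← BitVec.ofNat_add]
    refine Block.ends (p := 25) (B := record) ⟨_, rfl⟩ ?_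
    refine (hl.block_record (u := L.length + 1) (hr2.congr (by simp)) hL (by simp)).mono ?_
    rintro r₃ _ rfl
    have hx : ∀ z : BitVec w, Function.update (Function.update (Function.update r₂ 13 z) 18
        (BitVec.ofNat w e)) 5 (BitVec.ofNat w (L.length + 1)) 0 = BitVec.ofNat w n := by
      intro z
      simp [k6, h0]
    have hy : ∀ z : BitVec w, Function.update (Function.update (Function.update r₂ 13 z) 18
        (BitVec.ofNat w e)) 5 (BitVec.ofNat w (L.length + 1)) 18 = BitVec.ofNat w e := by
      intro z
      simp
    simp only [hx, hy]
    have hend := fun i (hi : i ≤ L.length + 1) =>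
      hl.isEnd_setTop m hL (BitVec.ofNat w n) (BitVec.ofNat w e) (hi.trans hL)
    refine .halt rfl ⟨?_, ?_⟩
    · have hlt' := Layout.lt_dataAddr (c := c) (w := w) (M := M) (L.length + 1)
      have hat : ∀ i ≤ L.length + 1, (L.add n).at i = if i ≤ L.length then min (L.at i) n else n := by
        intro i hi
        split_ifs with h
        · exact Bounds.at_add L n h
        · rw [show i = L.length + 1 by omega, Bounds.at_add_last]
      constructor
      · rw [hl.get_setTop_zero _ hL, Bounds.length_add]
      · rw [hl.get_setTop _ hL _ _ (by omega) (by omega) (by omega) (by omega), h1]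
      · rw [hl.get_setTop _ hL _ _ (by omega) (by omega) (by omega) (by omega), h2]
      · rwa [Bounds.length_add]
      · intro i hi
        rw [Bounds.length_add] at hi
        rw [hat i hi]
        split_ifs <;> omega
      · intro i k hik hk
        rw [Bounds.length_add] at hk
        rw [hat k hk, hat i (hik.trans hk)]
        split_ifs with g1 g2
        · have := hmono i k hik g2
          omega
        all_goals omega
      · rw [Bounds.length_add]
        refine hc.push (n := n) heL hend hno ?_ ?_
          (fun i hi => hl.get_setTop_val_ne _ hL _ _ (by omega))
          (fun i hi => hl.get_setTop_link_ne _ hL _ _ (by omega))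
          (hl.get_setTop_val _ hL _ _) (hl.get_setTop_link _ hL _ _)
        -- By monotonicity every version up to `e` has a boundary at most that of `e`, hence at most
        -- `n`, and is left unchanged.
        · intro i hi
          rw [Bounds.at_add L n (hi.trans heL)]
          exact min_eq_left ((hmono i e hi heL).trans hcmp)
        · intro i hi hi'
          rw [hat i hi']
          split_ifs with h
          · exact min_eq_right (hB i hi h).le
          · rfl
    · rw [Bounds.length_add, numEnds_push hend]
      simp [locate, address, record]
      -- The last round takes 37 steps, and the new mark adds 21 for potential; 60 covers both.
      omega

theorem add_spec (hl : Layout c w M S) {L : Bounds} (hm : Represents c M m L) {n : ℕ}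
    (hn : n < 2 ^ w) (hL : L.length + 1 ≤ c * w) :
    ∃ t m' y, Call (addProgram c) m (BitVec.ofNat w n) t m' y ∧
      Represents c M m' (L.add n) ∧
      t + 21 * numEnds m' (L.add n).length ≤ 21 * numEnds m L.length + 68 := by
  suffices h : Ends (addProgram c)
      ⟨0, Function.update (fun _ => 0) 0 (BitVec.ofNat w n), m⟩ (fun t m' _ =>
        Represents c M m' (L.add n) ∧
        t + 21 * numEnds m' (L.add n).length ≤ 21 * numEnds m L.length + 68) from h.call
  refine Block.ends (B := setup c) ⟨_, rfl⟩ ?_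
  refine (hl.block_setup hm.version hm.width hm.modulus (by simp)).mono ?_
  rintro r₁ _ ⟨rfl, hr, h10, h0⟩
  rw [Function.update_self] at h0
  refine Block.ends (B := [.copy 5 10]) ⟨_, rfl⟩ ?_
  simp only [Block]
  refine (ends_add_loop hl hn hL hm.lt hm.mono le_rfl (hr.congr (by simp)) (by simp [h0])
    (by simp [h10]) (by simp [h10]) hm.width hm.modulus hm.chain (fun i hi hi' => by omega)
    (fun i hi hi' => by omega)).mono ?_
  rintro t m' - ⟨g1, g2⟩
  refine ⟨g1, ?_⟩
  simp [setup]
  omega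

end VersionBoundary

/-! ### Initialization, and whole sequences of operations. -/

namespace VersionBoundary

open WordRAM

variable {c w S : ℕ}

/-- The lower bound on the modulus makes `w ≤ 2 * 3 ^ j`, so that hashing is injective; the upper
bound keeps the data within `12 * (c + 1) * w` words. -/
theorem layout_three_pow {j : ℕ} (hw : 0 < w) (hS : (13 * c + 16) * w ≤ S) (hS' : S ≤ 2 ^ w)
    (h1 : 2 * w ≤ 3 ^ (j + 1)) (h2 : 3 ^ (j + 1) < 6 * w) : Layout c w (3 ^ (j + 1)) S where
  w_pos := hw
  M_pos := by positivity
  inj k hk l hl h := two_pow_mod_three_pow_inj (by rw [pow_succ] at h1; omega)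
    (by rw [pow_succ] at h1; omega) h
  cw_lt := by
    have : (13 * c + 16) * w = 13 * (c * w) + 16 * w := by ring
    omega
  size := by
    have h3 : (c + 1) * 3 ^ (j + 1) ≤ (c + 1) * (6 * w) := Nat.mul_le_mul_left _ h2.le
    have h4 : c ≤ c * w := Nat.le_mul_of_pos_right c hw
    have h5 : (13 * c + 16) * w = 13 * (c * w) + 16 * w := by ring
    have h6 : (c + 1) * (6 * w) = 6 * (c * w) + 6 * w := by ring
    omega
  S_le := hS'

/-- The loop that computes a power of three which is at least `2 * w`. -/
theorem ends_init_loop {r : ℕ → BitVec w} {m : Memory w S} (hw : 0 < w) (hS : 16 * w ≤ S)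
    (hS' : S ≤ 2 ^ w) {i : ℕ} (hi : 3 ^ i < 6 * w) (h3 : r 3 = BitVec.ofNat w 3)
    (h5 : r 5 = BitVec.ofNat w (2 * w)) (h12 : r 12 = BitVec.ofNat w (3 ^ i)) :
    Ends (initProgram c) ⟨9, r, m⟩ fun t m' _ => ∃ j, 2 * w ≤ 3 ^ j ∧ 3 ^ j < 6 * w ∧
      m' = m.put 2 (BitVec.ofNat w (3 ^ j)) ∧ t ≤ 3 * (2 * w - 3 ^ i) + 3 := by
  have t5 : (r 5).toNat = 2 * w := by rw [h5, toNat_ofNat_of_lt (by omega)]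
  have t12 : (r 12).toNat = 3 ^ i := by rw [h12, toNat_ofNat_of_lt (by omega)]
  by_cases hlt : 3 ^ i < 2 * w
  · have hs : 3 ^ (i + 1) = 3 ^ i * 3 := pow_succ 3 i
    have hpos : 0 < 3 ^ i := by positivity
    refine .jumpLt_pos (l := 13) rfl (by rwa [t5, t12]) ?_
    refine Block.ends (p := 13) (B := [.op .mul 12 12 3]) ⟨_, rfl⟩ ?_
    simp only [Block, BinOp.eval, h3, h12, ← BitVec.ofNat_mul, ← hs]
    refine .jump (p := 14) rfl ?_
    refine (ends_init_loop hw hS hS' (i := i + 1) (by omega) (by simp [h3]) (by simp [h5])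
      (by simp)).mono ?_
    rintro t m' - ⟨j, g1, g2, g3, g4⟩
    refine ⟨j, g1, g2, g3, ?_⟩
    simp only [List.length_cons, List.length_nil]
    omega
  · have t2 : (BitVec.ofNat w 2).toNat = 2 := toNat_ofNat_of_lt (by omega)
    refine .jumpLt_neg (l := 13) rfl (by rwa [t5, t12]) ?_
    refine Block.ends (p := 10) (B := [.const 2 2, .store 2 12]) ⟨_, rfl⟩ ?_
    simp only [Block, Function.update_apply, Nat.reduceEqDiff, reduceIte, t2, h12]
    exact ⟨by omega, .halt rfl ⟨i, by omega, hi, rfl, by simp⟩⟩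
termination_by 2 * w - 3 ^ i

theorem init_spec (hw : 0 < w) (hS : (13 * c + 16) * w ≤ S) (hS' : S ≤ 2 ^ w)
    (m : Memory w S) :
    ∃ t m' y, Call (initProgram c) m (BitVec.ofNat w w) t m' y ∧ t ≤ 68 * w ∧
      ∃ M, Layout c w M S ∧ Represents c M m' [] := by
  suffices h : Ends (initProgram c)
      ⟨0, Function.update (fun _ => 0) 0 (BitVec.ofNat w w), m⟩ (fun t m' _ => t ≤ 68 * w ∧
        ∃ M, Layout c w M S ∧ Represents c M m' []) from h.call
  have hcS : c + 16 ≤ S := by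
    have h4 : c ≤ c * w := Nat.le_mul_of_pos_right c hw
    have h5 : (13 * c + 16) * w = 13 * (c * w) + 16 * w := by ring
    omega
  have h16 : 16 * w ≤ S := (Nat.mul_le_mul_right w (by omega)).trans hS
  have t0 : (BitVec.ofNat w 0).toNat = 0 := toNat_ofNat_of_lt (by omega)
  have t1 : (BitVec.ofNat w 1).toNat = 1 := toNat_ofNat_of_lt (by omega)
  have t3 : (BitVec.ofNat w 3).toNat = 3 := toNat_ofNat_of_lt (by omega)
  have t6 : (BitVec.ofNat w (c + 6)).toNat = c + 6 := toNat_ofNat_of_lt (by omega)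
  have g0 : 0 < S := by omega
  have g1 : 1 < S := by omega
  have g3 : 3 < S := by omega
  have g6 : c + 6 < S := by omega
  refine Block.ends (B := [.store 15 15, .const 1 1, .store 1 0, .const 3 3, .store 3 1,
    .const 4 (c + 6), .store 4 15, .const 12 1, .op .add 5 0 0]) ⟨_, rfl⟩ ?_
  simp only [Block, BinOp.eval, Function.update_apply, Nat.reduceEqDiff, OfNat.ofNat_ne_zero,
    OfNat.zero_ne_ofNat, OfNat.ofNat_ne_one, OfNat.one_ne_ofNat, zero_ne_one, reduceIte,
    BitVec.ofNat_eq_ofNat, t0, t1, t3, t6, g0, g1, g3, g6, true_and, ← BitVec.ofNat_add]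
  refine (ends_init_loop hw h16 hS' (i := 0) (by omega) (by simp) (by simp [two_mul])
    (by simp)).mono ?_
  rintro t m' - ⟨j, h1, h2, rfl, h3⟩
  refine ⟨by simp only [List.length_cons, List.length_nil]; omega, 3 ^ j, ?_⟩
  obtain ⟨j, rfl⟩ : ∃ i, j = i + 1 := by
    refine Nat.exists_eq_succ_of_ne_zero ?_
    rintro rfl
    omega
  refine ⟨layout_three_pow hw hS hS' h1 h2, ?_⟩
  have hget : ∀ a, ((((((m.put 0 0#w).put 1 (BitVec.ofNat w w)).put 3 1#w).put (c + 6) 0#w).put 2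
      (BitVec.ofNat w (3 ^ (j + 1))))).get a = if a = 2 then BitVec.ofNat w (3 ^ (j + 1)) else
        if a = c + 6 then 0#w else if a = 3 then 1#w else if a = 1 then BitVec.ofNat w w else
        if a = 0 then 0#w else m.get a := by
    intro a
    rw [Memory.get_put _ (by omega), Memory.get_put _ g6, Memory.get_put _ g3,
      Memory.get_put _ g1, Memory.get_put _ g0]
  have hat : Bounds.at [] 0 = 0 := rfl
  constructor
  · rw [hget]; simp
  · rw [hget]; simp
  · rw [hget]; simp
  · simp
  · simp [hat]
  · intro i k hik hk
    obtain rfl : k = 0 := by simpa using hk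
    obtain rfl : i = 0 := by omega
    exact le_rfl
  · constructor
    · rw [List.length_nil, isEnd, Nat.zero_div, Nat.zero_mod, add_zero, hget]; simp [hw]
    · intro i hi _
      obtain rfl : i = 0 := by simpa using hi
      -- The sentinel is bit `0` of block `0`, hashed to `1 % M = 1`; hence its value is stored at
      -- `c + 4 + 2 * 1 = c + 6`.
      have hone : 1 % 3 ^ (j + 1) = 1 :=
        Nat.mod_eq_of_lt (Nat.one_lt_pow (Nat.succ_ne_zero j) (by norm_num))
      have hd : dataAddr c w (3 ^ (j + 1)) 0 = c + 6 := by
        simp [dataAddr, slot, hone]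
      rw [hd, hget, if_neg (by omega), if_pos rfl, hat]
    · simp
    · intro i hi h0
      obtain rfl : i = 0 := by simpa using hi
      omega

/-- The potential bounds telescope; the initial potential stays as an additive term so that the
induction goes through from any state. -/
theorem exists_log {M : ℕ} (hl : Layout c w M S) (ops : List Op) {L : Bounds}
    {m : Memory w S} (hm : Represents c M m L) (hops : Legal w (c * w) L ops) :
    ∃ log : List (Op × ℕ), log.map Prod.fst = ops ∧
      Executes ⟨initProgram c, addProgram c, removeProgram c, minboundProgram c⟩ m L log ∧
      (∀ e ∈ log, e.1.isAdd = false → e.2 ≤ 4 * c + 68) ∧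
      ((log.filter fun e => e.1.isAdd).map Prod.snd).sum ≤
        (4 * c + 68) * (log.filter fun e => e.1.isAdd).length + 21 * numEnds m L.length := by
  induction ops generalizing L m with
  | nil => exact ⟨[], rfl, .nil m L, by simp, by simp⟩
  | cons op ops ih =>
    cases op with
    | add n =>
      obtain ⟨h1, h2, h3⟩ := hops
      obtain ⟨t, m', y, hcall, hm', ht⟩ := add_spec hl hm h1 h2
      obtain ⟨log, k1, k2, k3, k4⟩ := ih hm' h3
      refine ⟨(.add n, t) :: log, by simp [k1], .add m m' L n t y log hcall k2, ?_, ?_⟩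
      · simpa [Op.isAdd] using k3
      · simp only [Op.isAdd, List.filter_cons_of_pos, List.map_cons, List.sum_cons,
          List.length_cons, mul_add, mul_one] at k4 ⊢
        omega
    | remove j =>
      obtain ⟨h1, h2, h3⟩ := hops
      obtain ⟨t, m', y, hcall, ht, hm', hends⟩ := remove_spec hl hm h2
      obtain ⟨log, k1, k2, k3, k4⟩ := ih hm' h3
      refine ⟨(.remove j, t) :: log, by simp [k1], .remove m m' L j t y log hcall k2, ?_, ?_⟩
      · rw [List.forall_mem_cons]
        exact ⟨fun _ => by simp only; omega, k3⟩
      · rw [List.filter_cons_of_neg (by simp [Op.isAdd])]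
        omega
    | minbound u =>
      obtain ⟨h1, h3⟩ := hops
      obtain ⟨t, y, hcall, ht, hy⟩ := minbound_spec hl hm h1
      obtain ⟨log, k1, k2, k3, k4⟩ := ih hm h3
      refine ⟨(.minbound u, t) :: log, by simp [k1], .minbound m m L u t y log hcall hy k2,
        ?_, ?_⟩
      · rw [List.forall_mem_cons]
        exact ⟨fun _ => by simp only; omega, k3⟩
      · rwa [List.filter_cons_of_neg (by simp [Op.isAdd])]

end VersionBoundary

theorem Nat.sq_le_two_pow {n : ℕ} (hn : 4 ≤ n) : n ^ 2 ≤ 2 ^ n := by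
  induction n, hn using Nat.le_induction with
  | base => norm_num
  | succ n hn ih =>
    rw [pow_succ 2 n]
    nlinarith

theorem mainTheorem4 (c : ℕ) :
    ∃ (I : VersionBoundary.Implementation) (K C w₀ : ℕ), ∀ w : ℕ, w₀ ≤ w →
      ∀ m₀ : WordRAM.Memory w (K * w),
        ∃ (t₀ : ℕ) (m₁ : WordRAM.Memory w (K * w)) (y₀ : BitVec w),
          WordRAM.Call I.init m₀ (BitVec.ofNat w w) t₀ m₁ y₀ ∧ t₀ ≤ C * w ∧
          ∀ ops : List VersionBoundary.Op, VersionBoundary.Legal w (c * w) [] ops →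
            ∃ log : List (VersionBoundary.Op × ℕ),
              log.map Prod.fst = ops ∧
              VersionBoundary.Executes I m₁ [] log ∧
              (∀ e ∈ log, e.1.isAdd = false → e.2 ≤ C) ∧
              ((log.filter (fun e => e.1.isAdd)).map Prod.snd).sum ≤
                C * (log.filter (fun e => e.1.isAdd)).length := by
  refine ⟨⟨VersionBoundary.initProgram c, VersionBoundary.addProgram c,
    VersionBoundary.removeProgram c, VersionBoundary.minboundProgram c⟩, 13 * c + 16, 4 * c + 68,
    13 * c + 16, fun w hw m₀ => ?_⟩
  -- All addresses must fit into a word: `w ≥ 13 * c + 16` bounds the memory size by `w ^ 2`.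
  have hS : (13 * c + 16) * w ≤ 2 ^ w :=
    (Nat.mul_le_mul_right w hw).trans ((sq w).symm.le.trans (Nat.sq_le_two_pow (by omega)))
  obtain ⟨t₀, m₁, y₀, hcall, ht, M, hl, hm⟩ :=
    VersionBoundary.init_spec (by omega) le_rfl hS m₀
  refine ⟨t₀, m₁, y₀, hcall, ht.trans (Nat.mul_le_mul_right w (by omega)), fun ops hops => ?_⟩
  obtain ⟨log, h1, h2, h3, h4⟩ := VersionBoundary.exists_log hl ops hm hops
  -- The sentinel is not counted, so the empty structure has potential `0`.
  exact ⟨log, h1, h2, h3, by simpa [VersionBoundary.numEnds] using h4⟩
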